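/- Let $B$ be a standard Brownian motion on a probability space $(\Omega,\mathcal F,P)$, let $X=(B,B)$, let $\mathbb F$ be the natural filtration of $X$, completed by null sets and made right-continuous, and let $\varrho(Y)=Y_1Y_2$. *Delays.* A delay is $\tau=(\tau_1,\tau_2)$ with $\tau_i:[0,\infty)\to[0,\infty)$, $\tau_i(t)\le t$. It is phased if there is an unbounded partition $0=s_0<s_1<\cdots$ of $[0,\infty)$ such that on each $(s_l,s_{l+1}]$ at most one component of $\tau$ is nonconstant. A sequence $(\tau^n)_{n\in\mathbb N}$ of delays is an rsdii (refining sequence of delays that increase to identity) if $\tau^n_i([0,t])\subset\tau^{n+1}_i([0,t])$ for all $n$ and $\overline{\bigcup_n\tau^n_i([0,t])}=[0,t]$, for $i=1,2$ and all $t\ge0$. Put $X\diamond\tau=(X_1\circ\tau_1,X_2\circ\tau_2)$ and, for a set $\mathcal T$ of delays, $\mathbb X=\{X\diamond\tau:\tau\in\mathcal T\}\cup\{X\}$. Let $\mathbb D_0$ be the set of real càdlàg processes starting in zero. *ISU decomposition.* An unbounded random partition is a sequence of finite $\mathbb F$-stopping times $0=s_0<s_1<\cdots$ with $\sup_l s_l=\infty$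 a.s.; a sequence $\gamma=(\gamma_n)$ of such partitions, $\gamma_n=(s^n_l)_{l\ge0}$, tends to the identity if $\sup_l|s^n_{l+1}-s^n_l|\to0$ a.s. For a permutation $\pi$ of $\{1,2\}$ (the update order) and a process $Y=(Y_1,Y_2)$ let $$D^{n}_i(t)=\sum_{l\ge0}\Big(\varrho\big(Y^{(n,l,i)}\big)(t)-\varrho\big(\tilde Y^{(n,l,i)}\big)(t)\Big),$$ where $Y^{(n,l,i)}_j$ is $Y_j$ stopped at $s^n_{l+1}$ if $\pi(j)\le\pi(i)$ and at $s^n_l$ otherwise, and $\tilde Y^{(n,l,i)}_j$ is $Y_j$ stopped at $s^n_{l+1}$ if $\pi(j)<\pi(i)$ and at $s^n_l$ otherwise. The ISU decomposition of $\varrho(Y)$ with respect to $\pi$ and $\gamma$ is $D=(D_1,D_2)$ with $D_i(t)=\lim_n D^n_i(t)$ in probability for all $i$ and $t\ge0$, provided these limits exist. An ISU decomposition scheme of $\varrho$ on $\mathbb X$ is a map $\delta^{ISU}:\mathbb X\to\mathbb D_0^2$ such that $\delta^{ISU}(Y)$ is the ISU decomposition of $\varrho(Y)$ for every $Y\in\mathbb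 X$. A scheme $\delta$ is stable at $X$ if $\delta(X\diamond\tau^n)(t-)\to\delta(X)(t-)$ in probability, for every $t\ge 0$ and every rsdii $(\tau^n)$ with all $\tau^n\in\mathcal T$. **Proposition.** There is a set $\mathcal T$ of continuous phased delays, each of which is a member of an rsdii contained in $\mathcal T$, and there are two rsdii $(\tau^n)$ and $(\tilde\tau^n)$ in $\mathcal T$, such that $\varrho$ maps $\mathbb X$ into $\mathbb D_0$ and, for every update order $\pi$ and every sequence $\gamma$ of unbounded random partitions tending to the identity, an ISU decomposition scheme $\delta^{ISU}$ of $\varrho$ on $\mathbb X$ exists and every such scheme satisfies: for all $t\ge0$, in probability as $n\to\infty$, $$\delta^{ISU}_1(X\diamond\tau^n)(t)\to\tfrac12B_t^2+\tfrac12t,\qquad \delta^{ISU}_1(X\diamond\tilde\tau^n)(t)\to\tfrac12B_t^2-\tfrac12t,$$ and $\delta^{ISU}$ is not stable at $X$. -/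

import Mathlib

open MeasureTheory ProbabilityTheory Filter Topology
open scoped NNReal ENNReal

namespace ISU

/-! ### Delays -/

/-- A two-dimensional (deterministic) delay: functions `τ i : [0, ∞) → [0, ∞)` with
`τ i t ≤ t`. -/
structure Delay where
  toFun : Fin 2 → ℝ≥0 → ℝ≥0
  le_self : ∀ i t, toFun i t ≤ t

/-- An unbounded (deterministic) partition `0 = s 0 < s 1 < ⋯` of `[0, ∞)`. -/
structure IsUnboundedPartition (s : ℕ → ℝ≥0) : Prop where
  zero : s 0 = 0
  strictMono : StrictMono s
  unbounded : Tendsto s atTop atTop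

/-- Both components of the delay are continuous. -/
def Delay.IsContinuous (τ : Delay) : Prop := ∀ i, Continuous (τ.toFun i)

/-- A delay is phased if, for some unbounded partition, on each `(s l, s (l + 1)]` at most one
component is nonconstant. -/
def Delay.IsPhased (τ : Delay) : Prop :=
  ∃ s : ℕ → ℝ≥0, IsUnboundedPartition s ∧ ∀ l : ℕ,
    {i : Fin 2 | ¬ ∃ c : ℝ≥0, ∀ t ∈ Set.Ioc (s l) (s (l + 1)), τ.toFun i t = c}.Subsingleton

/-- Refining sequences of delays that increase to identity (rsdii). -/
structure IsRSDII (τ : ℕ → Delay) : Prop where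
  refining : ∀ (i : Fin 2) (t : ℝ≥0) (n : ℕ),
    (τ n).toFun i '' Set.Icc 0 t ⊆ (τ (n + 1)).toFun i '' Set.Icc 0 t
  toIdentity : ∀ (i : Fin 2) (t : ℝ≥0),
    closure (⋃ n, (τ n).toFun i '' Set.Icc 0 t) = Set.Icc 0 t

/-- `T` is made up of continuous phased rsdii: every element is a continuous phased delay and
is a member of some rsdii contained in `T`. -/
structure ConsistsOfContinuousPhasedRSDII (T : Set Delay) : Prop where
  continuous : ∀ τ ∈ T, τ.IsContinuous
  phased : ∀ τ ∈ T, τ.IsPhased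
  rsdii : ∀ τ ∈ T, ∃ σ : ℕ → Delay, IsRSDII σ ∧ (∀ n, σ n ∈ T) ∧ τ ∈ Set.range σ

section Defs

variable {Ω : Type*} [mΩ : MeasurableSpace Ω]

/-! ### The filtration and random partitions -/

/-- The natural filtration of the `d`-dimensional process `X`, augmented by the measurable null
sets of `P` and made right-continuous. If `P` is complete these are all the null sets, so that
this is the natural filtration under the usual conditions. -/
def augmentedFiltration (P : Measure Ω) {d : ℕ} (X : Fin d → ℝ≥0 → Ω → ℝ)
    (hX : ∀ i t, Measurable (X i t)) : Filtration ℝ≥0 mΩ where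
  seq t := ⨅ s > t, ((⨆ i, ⨆ u ≤ s, MeasurableSpace.comap (X i u) inferInstance) ⊔
    MeasurableSpace.generateFrom {N : Set Ω | MeasurableSet N ∧ P N = 0})
  mono' := by
    intro a b hab
    exact le_iInf₂ fun s hs => iInf₂_le s (lt_of_le_of_lt hab hs)
  le' := by
    intro t
    refine (iInf₂_le (t + 1) (by simp)).trans (sup_le ?_ ?_)
    · exact iSup_le fun i => iSup₂_le fun u _ => (hX i u).comap_le
    · exact MeasurableSpace.generateFrom_le fun N hN => hN.1

/-- An unbounded random partition: finite stopping times `0 = s 0 < s 1 < ⋯` with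
`sup_l s l = ∞` almost surely. -/
structure RandomPartition (P : Measure Ω) (𝔽 : Filtration ℝ≥0 mΩ) where
  time : ℕ → Ω → ℝ≥0
  stopping : ∀ l, IsStoppingTime 𝔽 fun ω => (time l ω : WithTop ℝ≥0)
  zero : ∀ ω, time 0 ω = 0
  lt_succ : ∀ l ω, time l ω < time (l + 1) ω
  unbounded : ∀ᵐ ω ∂P, ∀ C : ℝ≥0, ∃ l, C ≤ time l ω

/-- A sequence of random partitions tends to the identity: the mesh tends to zero almost
surely. -/
def TendsToIdentity {P : Measure Ω} {𝔽 : Filtration ℝ≥0 mΩ}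
    (γ : ℕ → RandomPartition P 𝔽) : Prop :=
  ∀ᵐ ω ∂P, Tendsto
    (fun n => ⨆ k, (((γ n).time (k + 1) ω - (γ n).time k ω : ℝ≥0) : ℝ≥0∞)) atTop (𝓝 0)

/-! ### SU and ISU decompositions -/

/-- For a vector `β` of booleans, the process whose `j`-th component is `Y j` stopped at
`s (l + 1)` if `β j` is true and at `s l` otherwise. -/
noncomputable def stoppedAt {d : ℕ} (Y : Fin d → ℝ≥0 → Ω → ℝ) (s : ℕ → Ω → ℝ≥0) (l : ℕ)
    (β : Fin d → Bool) : Fin d → ℝ≥0 → Ω → ℝ :=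
  fun j => stoppedProcess (Y j) fun ω => (s (if β j then l + 1 else l) ω : WithTop ℝ≥0)

/-- The `i`-th component of the sequential updating decomposition of `F Y` along the times `s`
with update order `π` (component `j` is updated as number `π j`). -/
noncomputable def suDecomposition {d : ℕ}
    (F : (Fin d → ℝ≥0 → Ω → ℝ) → ℝ≥0 → Ω → ℝ) (Y : Fin d → ℝ≥0 → Ω → ℝ)
    (π : Equiv.Perm (Fin d)) (s : ℕ → Ω → ℝ≥0) (i : Fin d) (t : ℝ≥0) (ω : Ω) : ℝ :=
  ∑' l : ℕ, (F (stoppedAt Y s l fun j => decide (π j ≤ π i)) t ω -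
    F (stoppedAt Y s l fun j => decide (π j < π i)) t ω)

/-- `D` is the infinitesimal sequential updating decomposition of `F Y` with respect to the
order `π` and the partition sequence `γ`: for each component and each time, it is the limit in
probability of the SU decompositions. -/
def IsISUDecomposition {d : ℕ} {P : Measure Ω} {𝔽 : Filtration ℝ≥0 mΩ}
    (F : (Fin d → ℝ≥0 → Ω → ℝ) → ℝ≥0 → Ω → ℝ) (Y : Fin d → ℝ≥0 → Ω → ℝ)
    (π : Equiv.Perm (Fin d)) (γ : ℕ → RandomPartition P 𝔽) (D : Fin d → ℝ≥0 → Ω → ℝ) : Prop :=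
  ∀ i t, TendstoInMeasure P (fun n => suDecomposition F Y π (γ n).time i t) atTop (D i t)

/-! ### Decomposition schemes and stability -/

/-- The real processes with càdlàg paths starting in zero (almost surely). -/
def cadlagFromZero (P : Measure Ω) : Set (ℝ≥0 → Ω → ℝ) :=
  {D | (∀ t, AEMeasurable (D t) P) ∧ ∀ᵐ ω ∂P, D 0 ω = 0 ∧ ∀ t : ℝ≥0,
    ContinuousWithinAt (fun u => D u ω) (Set.Ici t) t ∧
      ∃ a : ℝ, Tendsto (fun u => D u ω) (𝓝[<] t) (𝓝 a)}

/-- The delayed process `(X 0 ∘ τ 0, X 1 ∘ τ 1)`. -/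
def delayed (X : Fin 2 → ℝ≥0 → Ω → ℝ) (τ : Delay) : Fin 2 → ℝ≥0 → Ω → ℝ :=
  fun i t ω => X i (τ.toFun i t) ω

/-- The set of all delayed versions of `X`, for delays in `T`, together with `X` itself. -/
def delayedFamily (X : Fin 2 → ℝ≥0 → Ω → ℝ) (T : Set Delay) : Set (Fin 2 → ℝ≥0 → Ω → ℝ) :=
  delayed X '' T ∪ {X}

/-- `δ`, regarded as a map on `delayedFamily X T` with values in pairs of càdlàg processes
starting in zero, is the ISU decomposition scheme of `ϱ` for the order `π` and the partition
sequence `γ`. -/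
structure IsISUScheme {P : Measure Ω} {𝔽 : Filtration ℝ≥0 mΩ}
    (ϱ : (Fin 2 → ℝ≥0 → Ω → ℝ) → ℝ≥0 → Ω → ℝ) (X : Fin 2 → ℝ≥0 → Ω → ℝ) (T : Set Delay)
    (π : Equiv.Perm (Fin 2)) (γ : ℕ → RandomPartition P 𝔽)
    (δ : (Fin 2 → ℝ≥0 → Ω → ℝ) → Fin 2 → ℝ≥0 → Ω → ℝ) : Prop where
  cadlag : ∀ Y ∈ delayedFamily X T, ∀ i, δ Y i ∈ cadlagFromZero P
  isISU : ∀ Y ∈ delayedFamily X T, IsISUDecomposition ϱ Y π γ (δ Y)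

/-- Stability of a decomposition scheme `δ` at `X` with respect to the delays in `T`: for each
rsdii in `T`, the left limits `δ (delayed X (τ n)) (t-)` converge in probability to
`δ X (t-)`. -/
def StableAt (P : Measure Ω) (T : Set Delay) (X : Fin 2 → ℝ≥0 → Ω → ℝ)
    (δ : (Fin 2 → ℝ≥0 → Ω → ℝ) → Fin 2 → ℝ≥0 → Ω → ℝ) : Prop :=
  ∀ τ : ℕ → Delay, IsRSDII τ → (∀ n, τ n ∈ T) → ∀ (i : Fin 2) (t : ℝ≥0),
    TendstoInMeasure P
      (fun n ω => Function.leftLim (fun u => δ (delayed X (τ n)) i u ω) t) atTop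
      (fun ω => Function.leftLim (fun u => δ X i u ω) t)

/-- The product functional `ϱ(Y) = Y₁ Y₂`. -/
def productFunctional (Y : Fin 2 → ℝ≥0 → Ω → ℝ) : ℝ≥0 → Ω → ℝ :=
  fun t ω => Y 0 t ω * Y 1 t ω

end Defs

end ISU

namespace ISU

/-! ### Riemann sums along a partition -/

/-- The sum `∑ Z (s l ∧ t) (Y (s (l + 1) ∧ t) - Y (s l ∧ t))`. -/
noncomputable def leftSum (s : ℕ → ℝ≥0) (Z Y : ℝ≥0 → ℝ) (t : ℝ≥0) : ℝ :=
  ∑' l, Z (min t (s l)) * (Y (min t (s (l + 1))) - Y (min t (s l)))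

lemma IsUnboundedPartition.exists_le {s : ℕ → ℝ≥0} (hs : IsUnboundedPartition s) (t : ℝ≥0) :
    ∃ L, t ≤ s L :=
  (hs.unbounded.eventually_ge_atTop t).exists

lemma IsUnboundedPartition.exists_mem_Ico {s : ℕ → ℝ≥0} (hs : IsUnboundedPartition s) (t : ℝ≥0) :
    ∃ l, s l ≤ t ∧ t < s (l + 1) := by
  classical
  have h : ∃ L, t < s L := (hs.unbounded.eventually_gt_atTop t).exists
  obtain ⟨k, hk⟩ : ∃ k, Nat.find h = k + 1 := by
    refine Nat.exists_eq_succ_of_ne_zero fun h0 => ?_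
    have := Nat.find_spec h
    rw [h0, hs.zero] at this
    exact not_lt_zero this
  exact ⟨k, not_lt.1 (Nat.find_min h (by omega)), hk ▸ Nat.find_spec h⟩

lemma leftSum_eq_sum {s : ℕ → ℝ≥0} (hs : Monotone s) (Z Y : ℝ≥0 → ℝ) {t : ℝ≥0} {L : ℕ}
    (h : t ≤ s L) :
    leftSum s Z Y t =
      ∑ l ∈ Finset.range L, Z (min t (s l)) * (Y (min t (s (l + 1))) - Y (min t (s l))) := by
  refine tsum_eq_sum fun l hl => ?_
  have hl' : L ≤ l := by simpa using hl
  rw [min_eq_left (h.trans (hs hl')), min_eq_left (h.trans (hs (by omega)))]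
  simp

lemma leftSum_zero (s : ℕ → ℝ≥0) (Z Y : ℝ≥0 → ℝ) : leftSum s Z Y 0 = 0 := by
  simp [leftSum]

/-- The increment of `leftSum` over an interval on which one of the paths is constant. -/
lemma leftSum_eq_add {s : ℕ → ℝ≥0} (hs : IsUnboundedPartition s) {Z Y : ℝ≥0 → ℝ} {a b : ℝ≥0}
    (hab : a ≤ b)
    (hc : (∀ u ∈ Set.Icc a b, Y u = Y a) ∨ (∀ u ∈ Set.Icc a b, Z u = Z a)) {k : ℕ}
    (hk : s k ≤ a) (hk' : a < s (k + 1)) :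
    leftSum s Z Y b = leftSum s Z Y a + Z a * (Y b - Y a) +
      (Z (s k) - Z a) * (Y (min b (s (k + 1))) - Y a) := by
  obtain ⟨L, hL, hkL⟩ :=
    ((hs.unbounded.eventually_ge_atTop b).and (eventually_gt_atTop k)).exists
  have hmono := hs.strictMono.monotone
  rw [leftSum_eq_sum hmono Z Y hL, leftSum_eq_sum hmono Z Y (hab.trans hL)]
  set g : ℕ → ℝ := fun l => Y (max a (min b (s l))) with hg
  have key : ∀ l ∈ Finset.range L,
      Z (min b (s l)) * (Y (min b (s (l + 1))) - Y (min b (s l))) =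
      Z (min a (s l)) * (Y (min a (s (l + 1))) - Y (min a (s l))) + Z a * (g (l + 1) - g l) +
      if l = k then (Z (s k) - Z a) * (Y (min b (s (k + 1))) - Y a) else 0 := by
    intro l _
    rcases lt_trichotomy l k with h | h | h
    · have h1 : s l ≤ a := (hmono h.le).trans hk
      have h2 : s (l + 1) ≤ a := (hmono h).trans hk
      simp [hg, h.ne, h1, h2, h1.trans hab, h2.trans hab]
    · subst h
      have h1 : a ≤ min b (s (l + 1)) := le_min hab hk'.le
      simp only [hg, min_eq_right hk, min_eq_right (hk.trans hab), min_eq_left hk'.le,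
        max_eq_left hk, max_eq_right h1, if_true]
      ring
    · have h1 : a ≤ s l := hk'.le.trans (hmono h)
      have h2 : a ≤ s (l + 1) := h1.trans (hmono (by omega))
      have h3 : a ≤ min b (s l) := le_min hab h1
      have h4 : a ≤ min b (s (l + 1)) := le_min hab h2
      simp only [hg, min_eq_left h1, min_eq_left h2, max_eq_right h3, max_eq_right h4, h.ne',
        if_false, sub_self, mul_zero, zero_add, add_zero]
      rcases hc with hc | hc
      · rw [hc _ ⟨h3, min_le_left _ _⟩, hc _ ⟨h4, min_le_left _ _⟩]; simp
      · rw [hc _ ⟨h3, min_le_left _ _⟩]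
  rw [Finset.sum_congr rfl key, Finset.sum_add_distrib, Finset.sum_add_distrib,
    ← Finset.mul_sum, Finset.sum_range_sub, Finset.sum_ite_eq' (Finset.range L) k,
    if_pos (Finset.mem_range.2 hkL)]
  simp [hg, hs.zero, hab, hL]

/-- Riemann sums along partitions with vanishing mesh converge if at each time at most one of the
two paths moves. -/
lemma tendsto_leftSum_of_phased {Z Y : ℝ≥0 → ℝ} (hZ : Continuous Z) (hY : Continuous Y)
    {p : ℕ → ℝ≥0} (hp : IsUnboundedPartition p)
    (hphase : ∀ k, (∀ u ∈ Set.Icc (p k) (p (k + 1)), Y u = Y (p k)) ∨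
      (∀ u ∈ Set.Icc (p k) (p (k + 1)), Z u = Z (p k)))
    {s : ℕ → ℕ → ℝ≥0} (hs : ∀ n, IsUnboundedPartition (s n))
    (hmesh : ∀ ε > 0, ∀ᶠ n in atTop, ∀ k, s n (k + 1) - s n k < ε) (t : ℝ≥0) :
    Tendsto (fun n => leftSum (s n) Z Y t) atTop (𝓝 (leftSum p Z Y t)) := by
  suffices h : ∀ k, ∀ t ≤ p k,
      Tendsto (fun n => leftSum (s n) Z Y t) atTop (𝓝 (leftSum p Z Y t)) by
    obtain ⟨k, hk⟩ := hp.exists_le t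
    exact h k t hk
  intro k
  induction k with
  | zero =>
    intro t ht
    rw [hp.zero, nonpos_iff_eq_zero] at ht
    simp [ht, leftSum_zero]
  | succ k ih =>
    intro t ht
    rcases le_total t (p k) with h | h
    · exact ih t h
    have hc : (∀ u ∈ Set.Icc (p k) t, Y u = Y (p k)) ∨ (∀ u ∈ Set.Icc (p k) t, Z u = Z (p k)) :=
      (hphase k).imp (fun H u hu => H u ⟨hu.1, hu.2.trans ht⟩)
        (fun H u hu => H u ⟨hu.1, hu.2.trans ht⟩)
    choose l hl hl' using fun n => (hs n).exists_mem_Ico (p k)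
    rw [leftSum_eq_add hp h hc le_rfl (hp.strictMono (Nat.lt_succ_self k))]
    simp_rw [fun n => leftSum_eq_add (hs n) h hc (hl n) (hl' n)]
    refine ((ih _ le_rfl).add tendsto_const_nhds).add ?_
    have hd : ∀ ε > 0, ∀ᶠ n in atTop, dist (s n (l n)) (p k) < ε ∧
        dist (min t (s n (l n + 1))) (p k) < ε := by
      intro ε hε
      filter_upwards [hmesh ⟨ε, hε.le⟩ hε] with n hn
      have h1 : ((s n (l n + 1) - s n (l n) : ℝ≥0) : ℝ) < ε := hn (l n)
      rw [NNReal.coe_sub ((hl n).trans (hl' n).le)] at h1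
      have h2 := NNReal.coe_le_coe.2 (hl n)
      have h3 := NNReal.coe_lt_coe.2 (hl' n)
      have h4 : p k ≤ min t (s n (l n + 1)) := le_min h (hl' n).le
      have h5 : min t (s n (l n + 1)) ≤ s n (l n + 1) := min_le_right _ _
      rw [← NNReal.coe_le_coe] at h4 h5
      rw [NNReal.dist_eq, NNReal.dist_eq, abs_lt, abs_lt]
      exact ⟨⟨by linarith, by linarith⟩, by linarith, by linarith⟩
    have hu : Tendsto (fun n => s n (l n)) atTop (𝓝 (p k)) :=
      Metric.tendsto_nhds.2 fun ε hε => (hd ε hε).mono fun n hn => hn.1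
    have hv : Tendsto (fun n => min t (s n (l n + 1))) atTop (𝓝 (p k)) :=
      Metric.tendsto_nhds.2 fun ε hε => (hd ε hε).mono fun n hn => hn.2
    have := (((hZ.tendsto _).comp hu).sub_const (Z (p k))).mul
      (((hY.tendsto _).comp hv).sub_const (Y (p k)))
    simpa using this

/-- Summation by parts. -/
lemma tsum_right_eq {s : ℕ → ℝ≥0} (hs : IsUnboundedPartition s) (Z Y : ℝ≥0 → ℝ) (t : ℝ≥0) :
    ∑' l, Z (min t (s (l + 1))) * (Y (min t (s (l + 1))) - Y (min t (s l))) =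
      Y t * Z t - Y 0 * Z 0 - leftSum s Y Z t := by
  obtain ⟨L, hL⟩ := hs.exists_le t
  have hmono := hs.strictMono.monotone
  rw [leftSum_eq_sum hmono Y Z hL, tsum_eq_sum (s := Finset.range L)]
  · have h := Finset.sum_range_sub (fun l => Y (min t (s l)) * Z (min t (s l))) L
    simp only [hs.zero, min_eq_left hL, min_eq_right (zero_le : (0 : ℝ≥0) ≤ t)] at h
    rw [← h, ← Finset.sum_sub_distrib]
    exact Finset.sum_congr rfl fun l _ => by ring
  · intro l hl
    have hl' : L ≤ l := by simpa using hl
    rw [min_eq_left (hL.trans (hmono hl')), min_eq_left (hL.trans (hmono (by omega)))]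
    simp

lemma leftSum_add_leftSum_of_phased {Z Y : ℝ≥0 → ℝ} {p : ℕ → ℝ≥0} (hp : IsUnboundedPartition p)
    (hphase : ∀ k, (∀ u ∈ Set.Icc (p k) (p (k + 1)), Y u = Y (p k)) ∨
      (∀ u ∈ Set.Icc (p k) (p (k + 1)), Z u = Z (p k))) (t : ℝ≥0) :
    leftSum p Z Y t + leftSum p Y Z t = Y t * Z t - Y 0 * Z 0 := by
  have h := tsum_right_eq hp Z Y t
  suffices h' : ∑' l, Z (min t (p (l + 1))) * (Y (min t (p (l + 1))) - Y (min t (p l))) =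
      leftSum p Z Y t by
    rw [h'] at h; linarith
  refine tsum_congr fun l => ?_
  rcases le_total t (p l) with h1 | h1
  · simp [min_eq_left h1, min_eq_left (h1.trans (hp.strictMono (Nat.lt_succ_self l)).le)]
  · have h2 : min t (p (l + 1)) ∈ Set.Icc (p l) (p (l + 1)) :=
      ⟨le_min h1 (hp.strictMono (Nat.lt_succ_self l)).le, min_le_right _ _⟩
    rw [min_eq_right h1]
    rcases hphase l with H | H
    · rw [H _ h2]; simp
    · rw [H _ h2]

section

variable {Ω : Type*} {Y : Fin 2 → ℝ≥0 → Ω → ℝ} {π : Equiv.Perm (Fin 2)} {s : ℕ → Ω → ℝ≥0}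

lemma stoppedAt_apply (l : ℕ) (β : Fin 2 → Bool) (j : Fin 2) (t : ℝ≥0) (ω : Ω) :
    stoppedAt Y s l β j t ω = Y j (min t (s (if β j then l + 1 else l) ω)) ω := by
  simp only [stoppedAt, stoppedProcess]
  rfl

lemma suDecomposition_of_lt {i j : Fin 2} (h : π i < π j) (t : ℝ≥0) (ω : Ω) :
    suDecomposition productFunctional Y π s i t ω =
      leftSum (fun l => s l ω) (fun u => Y j u ω) (fun u => Y i u ω) t := by
  refine tsum_congr fun l => ?_
  have hij : i ≠ j := fun h' => by simp [h'] at h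
  simp only [productFunctional, stoppedAt_apply]
  fin_cases i <;> fin_cases j <;> simp_all
  all_goals
    simp [h.not_ge, h.not_gt]
    ring

lemma suDecomposition_of_gt {i j : Fin 2} (h : π j < π i) {ω : Ω}
    (hs : IsUnboundedPartition fun l => s l ω) (t : ℝ≥0) :
    suDecomposition productFunctional Y π s i t ω =
      Y i t ω * Y j t ω - Y i 0 ω * Y j 0 ω -
        leftSum (fun l => s l ω) (fun u => Y i u ω) (fun u => Y j u ω) t := by
  rw [← tsum_right_eq hs (fun u => Y j u ω) (fun u => Y i u ω) t]
  refine tsum_congr fun l => ?_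
  have hij : i ≠ j := fun h' => by simp [h'] at h
  simp only [productFunctional, stoppedAt_apply]
  fin_cases i <;> fin_cases j <;> simp_all
  all_goals
    simp [h.le]
    ring

end

/-! ### Delays whose components move in turn -/

/-- The distance to the nearest integer. -/
noncomputable def wave (x : ℝ) : ℝ := |x - round x|

lemma abs_wave_sub_le (x y : ℝ) : |wave x - wave y| ≤ |x - y| := by
  rw [wave, wave, ← UnitAddCircle.norm_eq, ← UnitAddCircle.norm_eq]
  refine (abs_norm_sub_norm_le _ _).trans ?_
  rw [← AddCircle.coe_sub, UnitAddCircle.norm_eq]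
  simpa using round_le (x - y) 0

lemma wave_nonneg (x : ℝ) : 0 ≤ wave x := abs_nonneg _

lemma wave_le_half (x : ℝ) : wave x ≤ 1 / 2 := abs_sub_round x

lemma continuous_wave : Continuous wave :=
  (LipschitzWith.of_dist_le_mul (K := 1) fun x y => by
    simpa [Real.dist_eq] using abs_wave_sub_le x y).continuous

lemma wave_eq_of_le {x : ℝ} {k : ℕ} (h : (k : ℝ) ≤ x) (h' : x ≤ k + 1 / 2) : wave x = x - k := by
  rw [wave, abs_sub_round_eq_min]
  rcases h'.eq_or_lt with h' | h'
  all_goals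
    have : ⌊x⌋ = k := Int.floor_eq_iff.2 ⟨by simpa using h, by push_cast; linarith⟩
    rw [Int.fract, this, min_eq_left] <;> push_cast <;> linarith

lemma wave_eq_of_ge {x : ℝ} {k : ℕ} (h : (k : ℝ) + 1 / 2 ≤ x) (h' : x ≤ k + 1) :
    wave x = k + 1 - x := by
  rcases h'.eq_or_lt with h' | h'
  · rw [wave_eq_of_le (k := k + 1)] <;> push_cast <;> linarith
  · rw [wave, abs_sub_round_eq_min]
    have : ⌊x⌋ = k := Int.floor_eq_iff.2 ⟨by push_cast; linarith, by push_cast; linarith⟩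
    rw [Int.fract, this, min_eq_right] <;> push_cast <;> linarith

/-- A path with lag of order `h` which moves only in every other interval of length `h / 2`. -/
noncomputable def lagFun (c : ℝ) (h t : ℝ≥0) : ℝ≥0 :=
  Real.toNNReal (t - h + c * (h * wave (t / h)))

section lagFun

variable {c c' : ℝ} {h h' : ℝ≥0}

lemma abs_mul_wave_le (hc : |c| ≤ 1) (x : ℝ) : |c * (h * wave x)| ≤ h / 2 := by
  rw [abs_mul, abs_of_nonneg (mul_nonneg h.coe_nonneg (wave_nonneg x))]
  calc |c| * (h * wave x) ≤ 1 * (h * (1 / 2)) := by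
        have := wave_le_half x
        have := wave_nonneg x
        gcongr
    _ = h / 2 := by ring

lemma coe_lagFun_le (hc : |c| ≤ 1) (t : ℝ≥0) : (lagFun c h t : ℝ) ≤ max ((t : ℝ) - h / 2) 0 := by
  rw [lagFun, Real.coe_toNNReal']
  refine max_le_max ?_ le_rfl
  linarith [(abs_le.1 (abs_mul_wave_le (h := h) hc (t / h))).2]

lemma le_coe_lagFun (hc : |c| ≤ 1) (t : ℝ≥0) : (t : ℝ) - 3 / 2 * h ≤ lagFun c h t := by
  rw [lagFun, Real.coe_toNNReal']
  refine le_max_of_le_left ?_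
  linarith [(abs_le.1 (abs_mul_wave_le (h := h) hc (t / h))).1]

lemma lagFun_le_self (hc : |c| ≤ 1) (t : ℝ≥0) : lagFun c h t ≤ t := by
  rw [← NNReal.coe_le_coe]
  exact (coe_lagFun_le hc t).trans (max_le (by linarith [h.2]) t.2)

lemma lagFun_zero (hc : |c| ≤ 1) : lagFun c h 0 = 0 := nonpos_iff_eq_zero.1 (lagFun_le_self hc 0)

lemma continuous_lagFun : Continuous (lagFun c h) := by
  have := continuous_wave
  unfold lagFun
  fun_prop

lemma monotone_lagFun (hc : |c| ≤ 1) (hh : 0 < h) : Monotone (lagFun c h) := by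
  intro s t hst
  refine Real.toNNReal_le_toNNReal ?_
  have h0 : (0 : ℝ) < h := hh
  have hst' : (s : ℝ) ≤ t := hst
  have h1 : |c * (h * (wave (s / h) - wave (t / h)))| ≤ t - s := by
    rw [abs_mul, abs_mul, abs_of_pos h0]
    calc |c| * (h * |wave (s / h) - wave (t / h)|) ≤ 1 * (h * |(s : ℝ) / h - t / h|) := by
          have := abs_wave_sub_le ((s : ℝ) / h) (t / h)
          gcongr
      _ = t - s := by
          rw [← sub_div, abs_div, abs_of_pos h0, abs_sub_comm, abs_of_nonneg (by linarith)]
          field_simp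
  have := (abs_le.1 h1).2
  linarith

lemma lagFun_le_lagFun (hc : |c| ≤ 1) (hc' : |c'| ≤ 1) (hh : 4 * h' ≤ h) (t : ℝ≥0) :
    lagFun c h t ≤ lagFun c' h' t := by
  rw [← NNReal.coe_le_coe]
  have hh' : 4 * (h' : ℝ) ≤ h := by exact_mod_cast hh
  exact (coe_lagFun_le hc t).trans (max_le (by linarith [le_coe_lagFun (h := h') hc' t, h'.2])
    (lagFun _ _ _).2)

lemma image_lagFun (hc : |c| ≤ 1) (hh : 0 < h) (t : ℝ≥0) :
    lagFun c h '' Set.Icc 0 t = Set.Icc 0 (lagFun c h t) := by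
  refine Set.Subset.antisymm ?_ ?_
  · rintro _ ⟨u, hu, rfl⟩
    exact ⟨zero_le, monotone_lagFun hc hh hu.2⟩
  · simpa [lagFun_zero hc] using
      intermediate_value_Icc (zero_le : 0 ≤ t) (continuous_lagFun (c := c) (h := h)).continuousOn

lemma tendsto_lagFun (hc : |c| ≤ 1) {h : ℕ → ℝ≥0} (hh : Tendsto h atTop (𝓝 0)) (t : ℝ≥0) :
    Tendsto (fun n => lagFun c (h n) t) atTop (𝓝 t) := by
  rw [← NNReal.tendsto_coe]
  have h1 : Tendsto (fun n => (t : ℝ) - 3 / 2 * h n) atTop (𝓝 t) := by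
    simpa using ((NNReal.tendsto_coe.2 hh).const_mul (3 / 2)).const_sub (t : ℝ)
  exact tendsto_of_tendsto_of_tendsto_of_le_of_le h1 tendsto_const_nhds
    (fun n => le_coe_lagFun hc t) fun n => lagFun_le_self hc t

lemma lagFun_one_eq (hh : 0 < h) {t : ℝ≥0} {k : ℕ} (h1 : (k : ℝ≥0) * h + h / 2 ≤ t)
    (h2 : t ≤ (k : ℝ≥0) * h + h) : lagFun 1 h t = k * h := by
  have h0 : (0 : ℝ) < h := hh
  rw [← NNReal.coe_le_coe] at h1 h2
  push_cast at h1 h2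
  rw [lagFun, wave_eq_of_ge (k := k)]
  · have : (t : ℝ) - h + 1 * (h * (k + 1 - t / h)) = ((k * h : ℝ≥0) : ℝ) := by
      push_cast; field_simp; ring
    rw [this, Real.toNNReal_coe]
  · rw [le_div_iff₀ h0]; linarith
  · rw [div_le_iff₀ h0]; linarith

lemma lagFun_neg_one_eq (hh : 0 < h) {t : ℝ≥0} {k : ℕ} (h1 : (k : ℝ≥0) * h ≤ t)
    (h2 : t ≤ (k : ℝ≥0) * h + h / 2) : lagFun (-1) h t = ((k - 1 : ℕ) : ℝ≥0) * h := by
  have h0 : (0 : ℝ) < h := hh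
  rw [← NNReal.coe_le_coe] at h1 h2
  push_cast at h1 h2
  have : (t : ℝ) - h + (-1) * (h * (t / h - k)) = (k - 1) * h := by
    field_simp; ring
  rw [lagFun, wave_eq_of_le (k := k), this]
  · rcases k with _ | k
    · simp
    · rw [Nat.add_sub_cancel, Nat.cast_add_one, add_sub_cancel_right]
      exact_mod_cast Real.toNNReal_coe (r := (k : ℝ≥0) * h)
  · rw [le_div_iff₀ h0]; linarith
  · rw [div_le_iff₀ h0]; linarith

end lagFun

/-- The delay whose component `i` moves in the first half of each interval
`[k * h, (k + 1) * h]`, and whose other component moves in the second half. -/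
noncomputable def alternating (i : Fin 2) (h : ℝ≥0) : Delay where
  toFun j := lagFun (if j = i then 1 else -1) h
  le_self j t := lagFun_le_self (by split_ifs <;> simp) t

lemma alternating_isContinuous (i : Fin 2) (h : ℝ≥0) : (alternating i h).IsContinuous :=
  fun _ => continuous_lagFun

/-- The multiples of `h / 2`. -/
noncomputable def halfGrid (h : ℝ≥0) (k : ℕ) : ℝ≥0 := k * (h / 2)

lemma isUnboundedPartition_halfGrid {h : ℝ≥0} (hh : 0 < h) :
    IsUnboundedPartition (halfGrid h) where
  zero := by simp [halfGrid]
  strictMono := fun a b hab => by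
    have : (a : ℝ≥0) < b := by exact_mod_cast hab
    unfold halfGrid
    gcongr
  unbounded := by
    unfold halfGrid
    exact (tendsto_natCast_atTop_atTop (R := ℝ≥0)).atTop_mul_const (half_pos hh)

lemma halfGrid_two_mul (h : ℝ≥0) (k : ℕ) : halfGrid h (2 * k) = k * h := by
  simp only [halfGrid]; push_cast; field_simp

lemma halfGrid_two_mul_add_one (h : ℝ≥0) (k : ℕ) :
    halfGrid h (2 * k + 1) = k * h + h / 2 := by
  simp only [halfGrid]; push_cast; field_simp

lemma halfGrid_two_mul_add_two (h : ℝ≥0) (k : ℕ) :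
    halfGrid h (2 * k + 1 + 1) = k * h + h := by
  simp only [halfGrid]; push_cast; field_simp; ring

lemma lagFun_phased {h : ℝ≥0} (hh : 0 < h) (l : ℕ) :
    (∀ u ∈ Set.Icc (halfGrid h l) (halfGrid h (l + 1)),
      lagFun (-1) h u = lagFun (-1) h (halfGrid h l)) ∨
    (∀ u ∈ Set.Icc (halfGrid h l) (halfGrid h (l + 1)),
      lagFun 1 h u = lagFun 1 h (halfGrid h l)) := by
  obtain ⟨k, rfl | rfl⟩ := Nat.even_or_odd' l
  · left
    rintro u ⟨h1, h2⟩
    rw [halfGrid_two_mul] at *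
    rw [halfGrid_two_mul_add_one] at h2
    rw [lagFun_neg_one_eq hh h1 h2, lagFun_neg_one_eq hh le_rfl (by simp)]
  · right
    rintro u ⟨h1, h2⟩
    rw [halfGrid_two_mul_add_one] at *
    rw [halfGrid_two_mul_add_two] at h2
    rw [lagFun_one_eq hh h1 h2, lagFun_one_eq hh le_rfl (by gcongr; exact NNReal.half_le_self h)]

lemma alternating_isPhased (i : Fin 2) {h : ℝ≥0} (hh : 0 < h) : (alternating i h).IsPhased := by
  refine ⟨halfGrid h, isUnboundedPartition_halfGrid hh, fun l => ?_⟩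
  have key : ∀ c : ℝ, (∀ u ∈ Set.Icc (halfGrid h l) (halfGrid h (l + 1)),
      lagFun c h u = lagFun c h (halfGrid h l)) →
      ∃ c' : ℝ≥0, ∀ t ∈ Set.Ioc (halfGrid h l) (halfGrid h (l + 1)), lagFun c h t = c' :=
    fun c H => ⟨_, fun t ht => H t (Set.Ioc_subset_Icc_self ht)⟩
  rcases lagFun_phased hh l with H | H
  · refine fun j hj k hk => ?_
    have H' := key _ H
    simp only [Set.mem_ofPred_eq, alternating] at hj hk
    have hj' : j = i := by by_contra h'; rw [if_neg h'] at hj; exact hj H'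
    have hk' : k = i := by by_contra h'; rw [if_neg h'] at hk; exact hk H'
    rw [hj', hk']
  · refine fun j hj k hk => ?_
    have H' := key _ H
    simp only [Set.mem_ofPred_eq, alternating] at hj hk
    have hj' : j ≠ i := by intro h'; rw [if_pos h'] at hj; exact hj H'
    have hk' : k ≠ i := by intro h'; rw [if_pos h'] at hk; exact hk H'
    omega

lemma alternating_isRSDII (i : Fin 2) {h : ℕ → ℝ≥0} (hh : ∀ n, 0 < h n)
    (hh' : ∀ n, 4 * h (n + 1) ≤ h n) (hlim : Tendsto h atTop (𝓝 0)) :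
    IsRSDII fun n => alternating i (h n) := by
  have hc : ∀ j : Fin 2, |(if j = i then 1 else -1 : ℝ)| ≤ 1 := fun j => by split_ifs <;> simp
  refine ⟨fun j t n => ?_, fun j t => ?_⟩
  · simp only [alternating]
    rw [image_lagFun (hc j) (hh _), image_lagFun (hc j) (hh _)]
    exact Set.Icc_subset_Icc_right (lagFun_le_lagFun (hc j) (hc j) (hh' n) t)
  · refine Set.Subset.antisymm (closure_minimal (Set.iUnion_subset fun n => ?_) isClosed_Icc)
      fun u hu => ?_
    · rintro _ ⟨u, hu, rfl⟩
      exact ⟨zero_le, ((alternating i (h n)).le_self j u).trans hu.2⟩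
    · exact mem_closure_of_tendsto (tendsto_lagFun (hc j) hlim u)
        (Eventually.of_forall fun n => Set.mem_iUnion.2 ⟨n, u, hu, rfl⟩)

/-! ### The limit along the phases -/

lemma leftSum_lag_add (b : ℝ≥0 → ℝ) {h : ℝ≥0} (hh : 0 < h) {k : ℕ} {t : ℝ≥0}
    (h1 : k * h ≤ t) (h2 : t ≤ k * h + h) :
    leftSum (halfGrid h) (fun u => b (lagFun 1 h u)) (fun u => b (lagFun (-1) h u)) t =
      leftSum (halfGrid h) (fun u => b (lagFun 1 h u)) (fun u => b (lagFun (-1) h u)) (k * h) +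
        b (k * h) * (b (lagFun (-1) h t) - b ((k - 1 : ℕ) * h)) := by
  have hp := isUnboundedPartition_halfGrid hh
  have hk0 : lagFun (-1) h (k * h) = ((k - 1 : ℕ) : ℝ≥0) * h :=
    lagFun_neg_one_eq hh le_rfl (by simp)
  have key : ∀ t, k * h ≤ t → t ≤ k * h + h / 2 →
      leftSum (halfGrid h) (fun u => b (lagFun 1 h u)) (fun u => b (lagFun (-1) h u)) t =
      leftSum (halfGrid h) (fun u => b (lagFun 1 h u)) (fun u => b (lagFun (-1) h u)) (k * h) := by
    intro t h1 h2
    rw [leftSum_eq_add (k := 2 * k) hp h1]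
    · simp only [halfGrid_two_mul, sub_self, zero_mul, add_zero]
      rw [lagFun_neg_one_eq hh h1 h2, hk0]
      simp
    · left
      intro u hu
      simp only [lagFun_neg_one_eq hh hu.1 (hu.2.trans h2), hk0]
    · rw [halfGrid_two_mul]
    · rw [← halfGrid_two_mul]
      exact hp.strictMono (by omega)
  rcases le_total t (k * h + h / 2) with h3 | h3
  · rw [key t h1 h3, lagFun_neg_one_eq hh h1 h3]
    simp
  · rw [leftSum_eq_add (k := 2 * k + 1) hp h3, key _ (by simp) le_rfl]
    · simp only [halfGrid_two_mul_add_one, sub_self, zero_mul, add_zero]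
      rw [lagFun_one_eq hh le_rfl (by gcongr; exact NNReal.half_le_self h),
        lagFun_neg_one_eq hh (by simp) le_rfl]
    · right
      intro u hu
      simp only [lagFun_one_eq hh hu.1 (hu.2.trans h2),
        lagFun_one_eq hh le_rfl (show _ ≤ k * h + h by gcongr; exact NNReal.half_le_self h)]
    · rw [halfGrid_two_mul_add_one]
    · rw [← halfGrid_two_mul_add_one]
      exact hp.strictMono (by omega)

/-- The sum of the squared increments of `b` over the first `m` intervals of length `h`. -/
noncomputable def gridQV (b : ℝ≥0 → ℝ) (h : ℝ≥0) (m : ℕ) : ℝ :=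
  ∑ j ∈ Finset.range m, (b ((j + 1 : ℕ) * h) - b (j * h)) ^ 2

lemma leftSum_lag_grid (b : ℝ≥0 → ℝ) {h : ℝ≥0} (hh : 0 < h) (k : ℕ) :
    leftSum (halfGrid h) (fun u => b (lagFun 1 h u)) (fun u => b (lagFun (-1) h u)) (k * h) =
      (b ((k - 1 : ℕ) * h) ^ 2 - b 0 ^ 2 + gridQV b h (k - 1)) / 2 := by
  induction k with
  | zero => simp [leftSum_zero, gridQV]
  | succ k ih =>
    rw [leftSum_lag_add b hh (k := k) (by gcongr; simp) (by push_cast; rw [add_mul, one_mul]), ih,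
      lagFun_neg_one_eq hh le_rfl (by simp)]
    rcases k with _ | k
    · simp
    · simp only [Nat.add_sub_cancel, gridQV, Finset.sum_range_succ]
      ring

lemma leftSum_lag (b : ℝ≥0 → ℝ) {h : ℝ≥0} (hh : 0 < h) (t : ℝ≥0) :
    leftSum (halfGrid h) (fun u => b (lagFun 1 h u)) (fun u => b (lagFun (-1) h u)) t =
      (b ((⌊t / h⌋₊ - 1 : ℕ) * h) ^ 2 - b 0 ^ 2 + gridQV b h (⌊t / h⌋₊ - 1)) / 2 +
      b (⌊t / h⌋₊ * h) * (b (lagFun (-1) h t) - b ((⌊t / h⌋₊ - 1 : ℕ) * h)) := by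
  rw [leftSum_lag_add b hh, leftSum_lag_grid b hh]
  · exact (le_div_iff₀ hh).1 (Nat.floor_le zero_le)
  · have := (div_lt_iff₀ hh).1 (Nat.lt_floor_add_one (t / h))
    rw [add_mul, one_mul] at this
    exact this.le

lemma tendsto_floor_mul {h : ℕ → ℝ≥0} (hh : ∀ n, 0 < h n) (hlim : Tendsto h atTop (𝓝 0))
    (t : ℝ≥0) (i : ℕ) :
    Tendsto (fun n => ((⌊t / h n⌋₊ - i : ℕ) : ℝ≥0) * h n) atTop (𝓝 t) := by
  rw [← NNReal.tendsto_coe]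
  have h1 : Tendsto (fun n => (t : ℝ) - (i + 1) * h n) atTop (𝓝 t) := by
    simpa using ((NNReal.tendsto_coe.2 hlim).const_mul ((i : ℝ) + 1)).const_sub (t : ℝ)
  refine tendsto_of_tendsto_of_tendsto_of_le_of_le h1 tendsto_const_nhds (fun n => ?_) fun n => ?_
  · have h2 := (div_lt_iff₀ (hh n)).1 (Nat.lt_floor_add_one (t / h n))
    rw [← NNReal.coe_lt_coe] at h2
    rw [NNReal.coe_mul, NNReal.coe_natCast]
    push_cast at h2
    have h3 : ((⌊t / h n⌋₊ : ℕ) : ℝ) ≤ ((⌊t / h n⌋₊ - i : ℕ) : ℝ) + i := by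
      exact_mod_cast (by omega : ⌊t / h n⌋₊ ≤ (⌊t / h n⌋₊ - i) + i)
    have h4 : ((⌊t / h n⌋₊ : ℕ) : ℝ) * h n ≤ (((⌊t / h n⌋₊ - i : ℕ) : ℝ) + i) * h n :=
      mul_le_mul_of_nonneg_right h3 (h n).2
    linarith
  · rw [NNReal.coe_le_coe]
    refine le_trans ?_ ((le_div_iff₀ (hh n)).1 (Nat.floor_le (zero_le : 0 ≤ t / h n)))
    gcongr
    exact Nat.sub_le _ _

lemma tendsto_leftSum_lag_sub {b : ℝ≥0 → ℝ} (hb : Continuous b) {h : ℕ → ℝ≥0}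
    (hh : ∀ n, 0 < h n) (hlim : Tendsto h atTop (𝓝 0)) (t : ℝ≥0) :
    Tendsto (fun n => leftSum (halfGrid (h n)) (fun u => b (lagFun 1 (h n) u))
        (fun u => b (lagFun (-1) (h n) u)) t - gridQV b (h n) (⌊t / h n⌋₊ - 1) / 2) atTop
      (𝓝 ((b t ^ 2 - b 0 ^ 2) / 2)) := by
  have h0 := (hb.tendsto _).comp (tendsto_floor_mul hh hlim t 0)
  have h1 := (hb.tendsto _).comp (tendsto_floor_mul hh hlim t 1)
  have h2 := (hb.tendsto _).comp (tendsto_lagFun (c := -1) (by simp) hlim t)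
  have := ((((h1.pow 2).sub_const (b 0 ^ 2)).div_const 2)).add (h0.mul (h2.sub h1))
  simp only [sub_self, mul_zero, add_zero] at this
  refine this.congr fun n => ?_
  rw [leftSum_lag b (hh n)]
  simp only [Function.comp, Nat.sub_zero]
  ring

lemma comap_eval_le {Ω : Type*} (B : ℝ≥0 → Ω → ℝ) {u s : ℝ≥0} (hu : u ≤ s) :
    MeasurableSpace.comap (B u) inferInstance ≤
      MeasurableSpace.comap (fun ω (v : Set.Iic s) => B v ω) inferInstance := by
  rintro _ ⟨A, hA, rfl⟩
  exact ⟨(fun f => f ⟨u, hu⟩) ⁻¹' A, measurable_pi_apply (⟨u, hu⟩ : Set.Iic s) hA, rfl⟩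

lemma indep_of_le_eventuallyMeasurableSpace {Ω : Type*} {m₀ m₁ m₂ : MeasurableSpace Ω}
    {mΩ : MeasurableSpace Ω} {P : Measure Ω} (h : Indep m₀ m₂ P)
    (hle : m₁ ≤ eventuallyMeasurableSpace m₀ (ae P)) : Indep m₁ m₂ P := by
  rw [Indep_iff] at h ⊢
  intro A C hA hC
  obtain ⟨A', hA', hAA'⟩ := hle A hA
  rw [measure_congr (hAA'.inter (ae_eq_refl C)), measure_congr hAA']
  exact h A' C hA' hC

section

variable {Ω : Type*} [mΩ : MeasurableSpace Ω] {P : Measure Ω}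

/-! ### Convergence in probability -/

lemma tendstoInMeasure_add {ι : Type*} {l : Filter ι} {f f' : ι → Ω → ℝ} {g g' : Ω → ℝ}
    (hf : TendstoInMeasure P f l g) (hf' : TendstoInMeasure P f' l g') :
    TendstoInMeasure P (fun n ω => f n ω + f' n ω) l (fun ω => g ω + g' ω) := by
  rw [tendstoInMeasure_iff_norm] at *
  intro ε hε
  have h := (hf (ε / 2) (half_pos hε)).add (hf' (ε / 2) (half_pos hε))
  rw [add_zero] at h
  refine tendsto_of_tendsto_of_tendsto_of_le_of_le tendsto_const_nhds h (fun _ => zero_le)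
    fun n => (measure_mono fun ω hω => ?_).trans (measure_union_le _ _)
  by_contra h'
  simp only [Set.mem_union, Set.mem_ofPred_eq, not_or, not_le, Real.norm_eq_abs] at h' hω
  have := abs_add_le (f n ω - g ω) (f' n ω - g' ω)
  have h2 : f n ω + f' n ω - (g ω + g' ω) = f n ω - g ω + (f' n ω - g' ω) := by ring
  rw [h2] at hω
  linarith

lemma tendstoInMeasure_const_mul {ι : Type*} {l : Filter ι} {f : ι → Ω → ℝ} {g : Ω → ℝ}
    (hf : TendstoInMeasure P f l g) (c : ℝ) :
    TendstoInMeasure P (fun n ω => c * f n ω) l (fun ω => c * g ω) := by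
  rw [tendstoInMeasure_iff_norm] at *
  intro ε hε
  have hc : 0 < |c| + 1 := by positivity
  refine tendsto_of_tendsto_of_tendsto_of_le_of_le tendsto_const_nhds (hf (ε / (|c| + 1))
    (by positivity)) (fun _ => zero_le) fun n => measure_mono fun ω hω => ?_
  simp only [Set.mem_ofPred_eq, Real.norm_eq_abs, ← mul_sub, abs_mul] at hω ⊢
  rw [div_le_iff₀ hc]
  nlinarith [abs_nonneg (f n ω - g ω)]

lemma tendstoInMeasure_of_le {f : ℕ → Ω → ℝ} {g : Ω → ℝ} {r : ℕ → ℝ≥0∞} {δ : ℕ → ℝ}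
    (hδ : Tendsto δ atTop (𝓝 0)) (hr : Tendsto r atTop (𝓝 0))
    (h : ∀ n, P {ω | δ n ≤ ‖f n ω - g ω‖} ≤ r n) : TendstoInMeasure P f atTop g := by
  rw [tendstoInMeasure_iff_norm]
  intro ε hε
  refine tendsto_of_tendsto_of_tendsto_of_le_of_le' tendsto_const_nhds hr
    (Eventually.of_forall fun _ => zero_le) ?_
  filter_upwards [hδ.eventually (gt_mem_nhds hε)] with n hn
  exact (measure_mono fun ω hω => hn.le.trans hω).trans (h n)

/-! ### Increments of Brownian motion -/

variable {B : ℝ≥0 → Ω → ℝ}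

lemma hasLaw_increment (hB : IsPreBrownianReal B P) {s t : ℝ≥0} (hst : s ≤ t) :
    HasLaw (fun ω => B t ω - B s ω) (gaussianReal 0 (t - s)) P := by
  have h := (hB.shift s).hasLaw_eval (t - s)
  rwa [add_tsub_cancel_of_le hst] at h

lemma memLp_increment (hB : IsPreBrownianReal B P) {s t : ℝ≥0} (hst : s ≤ t) {p : ℝ≥0∞}
    (hp : p ≠ ⊤) : MemLp (fun ω => B t ω - B s ω) p P :=
  (hasLaw_increment hB hst).hasGaussianLaw.memLp hp

lemma integral_increment (hB : IsPreBrownianReal B P) {s t : ℝ≥0} (hst : s ≤ t) :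
    ∫ ω, (B t ω - B s ω) ∂P = 0 := by
  rw [(hasLaw_increment hB hst).integral_eq, integral_id_gaussianReal]

lemma integral_increment_sq [IsProbabilityMeasure P] (hB : IsPreBrownianReal B P) {s t : ℝ≥0}
    (hst : s ≤ t) : ∫ ω, (B t ω - B s ω) ^ 2 ∂P = (t - s : ℝ≥0) := by
  have h := variance_eq_sub (memLp_increment hB hst ENNReal.ofNat_ne_top)
  rw [(hasLaw_increment hB hst).variance_eq, variance_id_gaussianReal,
    integral_increment hB hst] at h
  simpa using h.symm

lemma memLp_increment_sq (hB : IsPreBrownianReal B P) {s t : ℝ≥0} (hst : s ≤ t) :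
    MemLp (fun ω => (B t ω - B s ω) ^ 2) 2 P := by
  have h := memLp_increment hB hst (p := 4) (by simp)
  have : ENNReal.HolderTriple 4 4 2 := ⟨by
    rw [← two_mul, show (4 : ℝ≥0∞) = 2 * 2 by norm_num,
      ENNReal.mul_inv (by simp) (by simp), ← mul_assoc, ENNReal.mul_inv_cancel (by simp) (by simp),
      one_mul]⟩
  simpa [pow_two, Pi.mul_def] using h.mul h (r := 2)

lemma variance_increment_sq (hB : IsPreBrownianReal B P) {s t : ℝ≥0} (hst : s ≤ t) :
    Var[fun ω => (B t ω - B s ω) ^ 2; P] =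
      ((t - s : ℝ≥0) : ℝ) ^ 2 * Var[fun x => x ^ 2; gaussianReal 0 1] := by
  have hlaw := hasLaw_increment hB hst
  have h1 : gaussianReal 0 (t - s) =
      (gaussianReal 0 1).map fun x => Real.sqrt (t - s : ℝ≥0) * x := by
    rw [gaussianReal_map_const_mul]
    congr 1
    · simp
    · rw [mul_one]
      ext
      simp [Real.sq_sqrt]
  have h2 : Var[fun ω => (B t ω - B s ω) ^ 2; P] = Var[fun x => x ^ 2; gaussianReal 0 (t - s)] := by
    rw [← hlaw.map_eq, variance_map (by fun_prop) hlaw.aemeasurable]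
    rfl
  rw [h2, h1, variance_map (by fun_prop) (by fun_prop), ← variance_const_mul]
  congr 1
  ext x
  simp [mul_pow, Real.sq_sqrt]

lemma integral_gridQV [IsProbabilityMeasure P] (hB : IsPreBrownianReal B P) (h : ℝ≥0) (m : ℕ) :
    ∫ ω, gridQV (fun u => B u ω) h m ∂P = m * h := by
  have hle : ∀ j : ℕ, (j : ℝ≥0) * h ≤ ((j + 1 : ℕ) : ℝ≥0) * h := fun j => by gcongr; simp
  simp only [gridQV]
  rw [integral_finsetSum]
  · simp_rw [fun j => integral_increment_sq hB (hle j), fun j : ℕ =>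
      show ((j + 1 : ℕ) : ℝ≥0) * h - j * h = h by push_cast; rw [add_mul]; simp]
    simp
  · exact fun j _ => (memLp_increment_sq hB (hle j)).integrable (by norm_num)

lemma memLp_gridQV (hB : IsPreBrownianReal B P) (h : ℝ≥0) (m : ℕ) :
    MemLp (fun ω => gridQV (fun u => B u ω) h m) 2 P :=
  memLp_finsetSum _ fun j _ => memLp_increment_sq hB (by gcongr; simp)

lemma variance_gridQV (hB : IsPreBrownianReal B P) (h : ℝ≥0) (m : ℕ) :
    Var[fun ω => gridQV (fun u => B u ω) h m; P] =
      m * ((h : ℝ) ^ 2 * Var[fun x => x ^ 2; gaussianReal 0 1]) := by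
  have hle : ∀ j : ℕ, (j : ℝ≥0) * h ≤ ((j + 1 : ℕ) : ℝ≥0) * h := fun j => by gcongr; simp
  have hmono : Monotone fun j : ℕ => (j : ℝ≥0) * h := monotone_nat_of_le_succ hle
  have hind := hB.hasIndepIncrements.nat hmono
  have := IndepFun.variance_sum (s := Finset.range m) (μ := P)
    (X := fun j ω => (B ((j + 1 : ℕ) * h) ω - B (j * h) ω) ^ 2)
    (fun j _ => memLp_increment_sq hB (hle j)) fun i _ j _ hij =>
      (hind.indepFun hij).comp (φ := fun x => x ^ 2) (ψ := fun x => x ^ 2) (by fun_prop)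
        (by fun_prop)
  have h2 : (fun ω => gridQV (fun u => B u ω) h m) =
      ∑ j ∈ Finset.range m, fun ω => (B ((j + 1 : ℕ) * h) ω - B (j * h) ω) ^ 2 := by
    ext ω
    simp [gridQV, Finset.sum_apply]
  rw [h2, this]
  simp_rw [fun j => variance_increment_sq hB (hle j), fun j : ℕ =>
      show ((j + 1 : ℕ) : ℝ≥0) * h - j * h = h by push_cast; rw [add_mul]; simp]
  simp

/-- The quadratic variation of Brownian motion along deterministic grids. -/
lemma tendstoInMeasure_gridQV [IsProbabilityMeasure P] (hB : IsPreBrownianReal B P)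
    {h : ℕ → ℝ≥0} {m : ℕ → ℕ} {t : ℝ≥0} (hh : Tendsto h atTop (𝓝 0))
    (hm : Tendsto (fun n => (m n : ℝ≥0) * h n) atTop (𝓝 t)) :
    TendstoInMeasure P (fun n ω => gridQV (fun u => B u ω) (h n) (m n)) atTop
      (fun _ => (t : ℝ)) := by
  have h1 : TendstoInMeasure P (fun n ω => gridQV (fun u => B u ω) (h n) (m n) - m n * h n) atTop
      (fun _ => (0 : ℝ)) := by
    rw [tendstoInMeasure_iff_norm]
    intro ε hε
    have hlim : Tendsto (fun n => ENNReal.ofReal ((m n * ((h n : ℝ) ^ 2 *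
        Var[fun x => x ^ 2; gaussianReal 0 1])) / ε ^ 2)) atTop (𝓝 0) := by
      rw [← ENNReal.ofReal_zero]
      refine (ENNReal.continuous_ofReal.tendsto _).comp ?_
      have := ((((NNReal.tendsto_coe.2 hm).mul (NNReal.tendsto_coe.2 hh)).mul_const
        Var[fun x => x ^ 2; gaussianReal 0 1])).div_const (ε ^ 2)
      simp only [NNReal.coe_zero, mul_zero, zero_mul, zero_div] at this
      refine this.congr fun n => ?_
      push_cast
      ring
    refine tendsto_of_tendsto_of_tendsto_of_le_of_le tendsto_const_nhds hlim
      (fun _ => zero_le) fun n => ?_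
    have := meas_ge_le_variance_div_sq (memLp_gridQV hB (h n) (m n)) hε
    rw [variance_gridQV hB, integral_gridQV hB] at this
    simpa using this
  have h2 : TendstoInMeasure P (fun n (_ : Ω) => (m n : ℝ) * h n) atTop (fun _ => (t : ℝ)) :=
    tendstoInMeasure_of_tendsto_ae (fun n => aestronglyMeasurable_const)
      (Eventually.of_forall fun _ => by simpa using NNReal.tendsto_coe.2 hm)
  simpa using tendstoInMeasure_add h1 h2

/-! ### The augmented filtration -/

/-- The information up to time `s`, augmented by null sets. -/
abbrev augmentedPast (P : Measure Ω) (B : ℝ≥0 → Ω → ℝ) (s : ℝ≥0) : MeasurableSpace Ω :=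
  (⨆ u ≤ s, MeasurableSpace.comap (B u) inferInstance) ⊔
    MeasurableSpace.generateFrom {N : Set Ω | MeasurableSet N ∧ P N = 0}

lemma augmentedPast_mono : Monotone (augmentedPast P B) := fun _ _ h =>
  sup_le_sup_right (biSup_mono fun _ hu => hu.trans h) _

lemma augmentedPast_le (hB : ∀ t, Measurable (B t)) (s : ℝ≥0) : augmentedPast P B s ≤ mΩ :=
  sup_le (iSup₂_le fun u _ => (hB u).comap_le)
    (MeasurableSpace.generateFrom_le fun _ hN => hN.1)

lemma measurable_augmentedPast {u s : ℝ≥0} (h : u ≤ s) : Measurable[augmentedPast P B s] (B u) :=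
  (comap_measurable (B u)).mono
    ((le_iSup₂_of_le (f := fun u _ => MeasurableSpace.comap (B u) inferInstance) u h le_rfl).trans
      le_sup_left) le_rfl

lemma augmentedFiltration_le_augmentedPast (hB : ∀ t, Measurable (B t)) {q s : ℝ≥0} (h : q < s) :
    augmentedFiltration P (fun _ : Fin 2 => B) (fun _ t => hB t) q ≤ augmentedPast P B s := by
  refine (iInf₂_le s h).trans (sup_le_sup_right ?_ _)
  exact iSup_le fun _ => le_rfl

lemma measurableSet_stopping_lt (hB : ∀ t, Measurable (B t)) {σ : Ω → ℝ≥0}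
    (hσ : IsStoppingTime (augmentedFiltration P (fun _ : Fin 2 => B) (fun _ t => hB t))
      fun ω => (σ ω : WithTop ℝ≥0)) (s : ℝ≥0) :
    MeasurableSet[augmentedPast P B s] {ω | σ ω < s} := by
  have h : {ω | σ ω < s} =
      ⋃ q : ℚ, ⋃ _ : Real.toNNReal q < s, {ω | σ ω ≤ Real.toNNReal q} := by
    ext ω
    simp only [Set.mem_ofPred_eq, Set.mem_iUnion, exists_prop]
    constructor
    · intro h
      obtain ⟨q, _, h1, h2⟩ := (NNReal.lt_iff_exists_rat_btwn _ _).1 h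
      exact ⟨q, h2, h1.le⟩
    · rintro ⟨q, h1, h2⟩
      exact h2.trans_lt h1
  rw [h]
  refine MeasurableSet.iUnion fun q => MeasurableSet.iUnion fun hq => ?_
  refine augmentedFiltration_le_augmentedPast hB hq _ ?_
  have := hσ (Real.toNNReal q)
  simp only [WithTop.coe_le_coe] at this
  exact this

lemma indep_augmentedPast (hB : IsPreBrownianReal B P)
    {s t : ℝ≥0} (hst : s ≤ t) :
    Indep (augmentedPast P B s) (MeasurableSpace.comap (fun ω => B t ω - B s ω) inferInstance)
      P := by
  refine indep_of_le_eventuallyMeasurableSpace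
    (m₀ := MeasurableSpace.comap (fun ω (u : Set.Iic s) => B u ω) inferInstance) ?_ ?_
  · have hψ : Measurable fun f : ℝ≥0 → ℝ => f (t - s) := measurable_pi_apply _
    have h := (hB.indepFun_shift s).symm.comp measurable_id hψ
    simp only [Function.comp_def, add_tsub_cancel_of_le hst, id] at h
    exact h
  · refine sup_le (iSup₂_le fun u hu => ?_) (MeasurableSpace.generateFrom_le fun N hN => ?_)
    · exact fun A hA => ⟨A, comap_eval_le B hu A hA, ae_eq_refl A⟩
    · exact ⟨∅, MeasurableSpace.measurableSet_empty _, ae_eq_empty.2 hN.2⟩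

/-! ### Martingale transforms with bounded integrands -/

lemma memLp_transform [IsProbabilityMeasure P] {ℱ : ℕ → MeasurableSpace Ω} (hmono : Monotone ℱ)
    (hle : ∀ j, ℱ j ≤ mΩ) {Δ H : ℕ → Ω → ℝ} {v ε : ℝ}
    (hΔm : ∀ j, Measurable[ℱ (j + 1)] (Δ j)) (hΔ2 : ∀ j, MemLp (Δ j) 2 P)
    (hΔ0 : ∀ j, ∫ ω, Δ j ω ∂P = 0) (hΔv : ∀ j, ∫ ω, Δ j ω ^ 2 ∂P = v)
    (hind : ∀ j, Indep (ℱ j) (MeasurableSpace.comap (Δ j) inferInstance) P)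
    (hH : ∀ j, Measurable[ℱ j] (H j)) (hHε : ∀ j ω, |H j ω| ≤ ε) (m : ℕ) :
    Measurable[ℱ m] (fun ω => ∑ j ∈ Finset.range m, H j ω * Δ j ω) ∧
      MemLp (fun ω => ∑ j ∈ Finset.range m, H j ω * Δ j ω) 2 P ∧
      ∫ ω, (∑ j ∈ Finset.range m, H j ω * Δ j ω) ^ 2 ∂P ≤ ε ^ 2 * (m * v) := by
  induction m with
  | zero => simp
  | succ m ih =>
    obtain ⟨ih1, ih2, ih3⟩ := ih
    have hHm := hmono (Nat.le_succ m)
    have hm' : Measurable[mΩ] (H m) := (hH m).mono (hle m) le_rfl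
    have hS : MemLp (fun ω => (∑ j ∈ Finset.range m, H j ω * Δ j ω) * H m ω) 2 P :=
      ih2.of_le_mul (c := ε) (by
        exact (ih2.1.mul hm'.aestronglyMeasurable)) (Eventually.of_forall fun ω => by
          rw [norm_mul, mul_comm]
          exact mul_le_mul_of_nonneg_right (hHε m ω) (norm_nonneg _))
    have hX : MemLp (fun ω => H m ω * Δ m ω) 2 P :=
      (hΔ2 m).of_le_mul (c := ε) (hm'.aestronglyMeasurable.mul (hΔ2 m).1)
        (Eventually.of_forall fun ω => by
          rw [norm_mul]
          exact mul_le_mul_of_nonneg_right (hHε m ω) (norm_nonneg _))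
    simp_rw [Finset.sum_range_succ]
    refine ⟨?_, ih2.add hX, ?_⟩
    · have h1 := ih1.mono hHm le_rfl
      have h2 := (hH m).mono hHm le_rfl
      exact h1.add (h2.mul (hΔm m))
    have hcross : ∫ ω, ((∑ j ∈ Finset.range m, H j ω * Δ j ω) * H m ω) * Δ m ω ∂P = 0 := by
      have hi : IndepFun (fun ω => (∑ j ∈ Finset.range m, H j ω * Δ j ω) * H m ω) (Δ m) P := by
        have h1 : Measurable[ℱ m] (fun ω => (∑ j ∈ Finset.range m, H j ω * Δ j ω) * H m ω) :=
          Measurable.mul ih1 (hH m)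
        exact indep_of_indep_of_le_left (hind m) h1.comap_le
      rw [hi.integral_fun_mul_eq_mul_integral hS.1 (hΔ2 m).1, hΔ0, mul_zero]
    have hexp : ∀ ω, ((∑ j ∈ Finset.range m, H j ω * Δ j ω) + H m ω * Δ m ω) ^ 2 =
        (∑ j ∈ Finset.range m, H j ω * Δ j ω) ^ 2 +
        2 * (((∑ j ∈ Finset.range m, H j ω * Δ j ω) * H m ω) * Δ m ω) +
        (H m ω * Δ m ω) ^ 2 := fun ω => by ring
    have hci : Integrable (fun ω => 2 * (((∑ j ∈ Finset.range m, H j ω * Δ j ω) * H m ω) *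
        Δ m ω)) P := (hS.integrable_mul (hΔ2 m)).const_mul 2
    have hvle : ∫ ω, (H m ω * Δ m ω) ^ 2 ∂P ≤ ε ^ 2 * v := by
      rw [← hΔv m, ← integral_const_mul]
      refine integral_mono hX.integrable_sq ((hΔ2 m).integrable_sq.const_mul _) fun ω => ?_
      simp only [mul_pow]
      exact mul_le_mul_of_nonneg_right (sq_le_sq' (by linarith [(abs_le.1 (hHε m ω)).1])
        (abs_le.1 (hHε m ω)).2) (sq_nonneg _)
    simp_rw [hexp]
    have hsi : Integrable (fun ω => (∑ j ∈ Finset.range m, H j ω * Δ j ω) ^ 2 +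
        2 * (((∑ j ∈ Finset.range m, H j ω * Δ j ω) * H m ω) * Δ m ω)) P :=
      ih2.integrable_sq.add hci
    rw [integral_add hsi hX.integrable_sq,
      integral_add ih2.integrable_sq hci, integral_const_mul, hcross]
    push_cast
    linarith

end

/-! ### Discretized partitions -/

/-- The index of the first point of the grid `{j * h}` after `s l`, capped at `m`. -/
noncomputable def gridIndex (s : ℕ → ℝ≥0) (h : ℝ≥0) (m l : ℕ) : ℕ :=
  if l = 0 then 0 else min m (⌊s l / h⌋₊ + 1)

/-- The increment of `b` between the last index among `N 0, …, N L` and `j`. -/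
noncomputable def lagIncrement (N : ℕ → ℕ) (b : ℕ → ℝ) (L j : ℕ) : ℝ :=
  ∑ l ∈ Finset.range L, if N l ≤ j ∧ j < N (l + 1) then b j - b (N l) else 0

lemma gridIndex_zero (s : ℕ → ℝ≥0) (h : ℝ≥0) (m : ℕ) : gridIndex s h m 0 = 0 := if_pos rfl

lemma gridIndex_le (s : ℕ → ℝ≥0) (h : ℝ≥0) (m l : ℕ) : gridIndex s h m l ≤ m := by
  unfold gridIndex
  split_ifs <;> simp

lemma gridIndex_mono {s : ℕ → ℝ≥0} (hs : Monotone s) (h : ℝ≥0) (m : ℕ) :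
    Monotone (gridIndex s h m) := by
  intro a b hab
  unfold gridIndex
  split_ifs with h1 h2
  · exact le_rfl
  · exact zero_le
  · omega
  · have := hs hab
    gcongr

lemma sum_sq_add_sum_sq_eq {N : ℕ → ℕ} (hN : Monotone N) (hN0 : N 0 = 0) {m : ℕ}
    (hNm : ∀ l, N l ≤ m) (b : ℕ → ℝ) (L : ℕ) :
    ∑ l ∈ Finset.range L, (b (N (l + 1)) - b (N l)) ^ 2 +
        ∑ j ∈ Finset.Ico (N L) m, (b (j + 1) - b j) ^ 2 =
      ∑ j ∈ Finset.range m, (b (j + 1) - b j) ^ 2 +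
        2 * ∑ j ∈ Finset.range m, lagIncrement N b L j * (b (j + 1) - b j) := by
  induction L with
  | zero => simp [hN0, lagIncrement]
  | succ L ih =>
    have h1 : ∑ j ∈ Finset.range m, lagIncrement N b (L + 1) j * (b (j + 1) - b j) =
        ∑ j ∈ Finset.range m, lagIncrement N b L j * (b (j + 1) - b j) +
        ∑ j ∈ Finset.Ico (N L) (N (L + 1)), (b j - b (N L)) * (b (j + 1) - b j) := by
      simp only [lagIncrement, Finset.sum_range_succ, add_mul, Finset.sum_add_distrib, ite_mul,
        zero_mul]
      congr 1
      rw [← Finset.sum_filter]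
      congr 1
      ext j
      simp only [Finset.mem_filter, Finset.mem_range, Finset.mem_Ico]
      have := hNm (L + 1)
      omega
    have h2 := Finset.sum_Ico_consecutive (fun j => (b (j + 1) - b j) ^ 2) (hN (Nat.le_succ L))
      (hNm (L + 1))
    have h3 : (b (N (L + 1)) - b (N L)) ^ 2 =
        ∑ j ∈ Finset.Ico (N L) (N (L + 1)), ((b (j + 1) - b j) ^ 2 +
          2 * ((b j - b (N L)) * (b (j + 1) - b j))) := by
      have h := Finset.sum_Ico_sub (fun j => (b j - b (N L)) ^ 2) (hN (Nat.le_succ L))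
      rw [sub_self, zero_pow two_ne_zero, sub_zero] at h
      rw [← h]
      exact Finset.sum_congr rfl fun j _ => by ring
    rw [Finset.sum_add_distrib, ← Finset.mul_sum] at h3
    rw [Finset.sum_range_succ, h1, h3]
    simp only [Nat.succ_eq_add_one] at h2
    linarith

lemma abs_lagIncrement_le {N : ℕ → ℕ} (hN : Monotone N) {b : ℕ → ℝ} {ε : ℝ} (hε : 0 ≤ ε) (L : ℕ)
    {j : ℕ} (h : ∀ l, N l ≤ j → j < N (l + 1) → |b j - b (N l)| ≤ ε) :
    |lagIncrement N b L j| ≤ ε := by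
  unfold lagIncrement
  by_cases H : ∃ l ∈ Finset.range L, N l ≤ j ∧ j < N (l + 1)
  · obtain ⟨l, hl, hlj⟩ := H
    rw [Finset.sum_eq_single_of_mem l hl, if_pos hlj]
    · exact h l hlj.1 hlj.2
    · intro k _ hk
      refine if_neg fun hk' => ?_
      rcases hk.lt_or_gt with h1 | h1
      · have := hN (Nat.succ_le_of_lt h1)
        simp only [Nat.succ_eq_add_one] at this
        omega
      · have := hN (Nat.succ_le_of_lt h1)
        simp only [Nat.succ_eq_add_one] at this
        omega
  · push Not at H
    rw [Finset.sum_eq_zero]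
    · simpa using hε
    · intro l hl
      refine if_neg fun h' => ?_
      have := H l hl h'.1
      omega

lemma measurable_lagIncrement {Ω : Type*} {m : MeasurableSpace Ω} {N : ℕ → Ω → ℕ} {j : ℕ}
    (hN : ∀ l, ∀ k ≤ j, MeasurableSet {ω | N l ω ≤ k}) {b : ℕ → Ω → ℝ}
    (hb : ∀ k ≤ j, Measurable (b k)) (L : ℕ) :
    Measurable fun ω => lagIncrement (fun l => N l ω) (fun k => b k ω) L j := by
  have h : ∀ ω, lagIncrement (fun l => N l ω) (fun k => b k ω) L j =
      ∑ l ∈ Finset.range L, ∑ k ∈ Finset.range (j + 1),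
        if N l ω = k ∧ j < N (l + 1) ω then b j ω - b k ω else 0 := by
    intro ω
    refine Finset.sum_congr rfl fun l _ => ?_
    dsimp only
    split_ifs with h
    · rw [Finset.sum_eq_single_of_mem (N l ω) (by simp; omega), if_pos ⟨rfl, h.2⟩]
      exact fun k _ hk => if_neg fun h' => hk h'.1.symm
    · refine (Finset.sum_eq_zero fun k hk => if_neg fun h' => h ?_).symm
      rw [Finset.mem_range] at hk
      exact ⟨by omega, h'.2⟩
  simp_rw [h]
  refine Finset.measurable_sum _ fun l _ => Finset.measurable_sum _ fun k hk => ?_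
  have hk' : k ≤ j := by rw [Finset.mem_range] at hk; omega
  refine Measurable.ite ?_ ((hb j le_rfl).sub (hb k hk')) measurable_const
  have h1 : MeasurableSet {ω | N l ω = k} := by
    rcases k with _ | k
    · simpa using hN l 0 hk'
    · have : {ω | N l ω = k + 1} = {ω | N l ω ≤ k + 1} \ {ω | N l ω ≤ k} := by
        ext ω
        simp only [Set.mem_ofPred_eq, Set.mem_sdiff]
        omega
      rw [this]
      exact (hN l _ hk').diff (hN l k (by omega))
  have h2 : MeasurableSet {ω | j < N (l + 1) ω} := by
    have : {ω | j < N (l + 1) ω} = {ω | N (l + 1) ω ≤ j}ᶜ := by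
      ext ω
      simp
    rw [this]
    exact (hN (l + 1) j le_rfl).compl
  exact h1.inter h2

/-- The step size of the grid which divides `[0, t]` into `n + 1` intervals. -/
noncomputable def step (t : ℝ≥0) (n : ℕ) : ℝ≥0 := t / (n + 1 : ℕ)

lemma step_pos {t : ℝ≥0} (ht : 0 < t) (n : ℕ) : 0 < step t n := by
  unfold step; positivity

lemma succ_mul_step (t : ℝ≥0) (n : ℕ) : ((n + 1 : ℕ) : ℝ≥0) * step t n = t := by
  unfold step
  exact mul_div_cancel₀ _ (by positivity)

lemma tendsto_step (t : ℝ≥0) : Tendsto (step t) atTop (𝓝 0) := by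
  unfold step
  exact (tendsto_const_div_atTop_nhds_zero_nat t).comp (tendsto_add_atTop_nat 1)

lemma tendsto_gridIndex_mul {s : ℕ → ℝ≥0} (hs0 : s 0 = 0) {t : ℝ≥0} (ht : 0 < t) (l : ℕ) :
    Tendsto (fun n => (gridIndex s (step t n) (n + 1) l : ℝ≥0) * step t n) atTop
      (𝓝 (min t (s l))) := by
  rcases l with _ | l
  · simp [gridIndex_zero, hs0]
  · have h1 := (tendsto_floor_mul (step_pos ht) (tendsto_step t) (s (l + 1)) 0).add (tendsto_step t)
    rw [add_zero] at h1
    refine (tendsto_const_nhds.min h1).congr fun n => ?_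
    rw [gridIndex, if_neg (Nat.succ_ne_zero l), Nat.cast_min, min_mul, succ_mul_step, Nat.cast_add_one,
      add_mul, one_mul, Nat.sub_zero]

lemma gridIndex_eq_of_le {s : ℕ → ℝ≥0} {t : ℝ≥0} (ht : 0 < t) {n l : ℕ} (hl : l ≠ 0)
    (h : t ≤ s l) : gridIndex s (step t n) (n + 1) l = n + 1 := by
  rw [gridIndex, if_neg hl, min_eq_left]
  refine le_trans (Nat.le_floor ?_) (Nat.le_succ _)
  rw [le_div_iff₀ (step_pos ht n), succ_mul_step]
  exact h

/-- The discretized sum of the products of the increments since the last point of the partition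
`s` with the next increments of `b`. -/
noncomputable def lagTransform (s : ℕ → ℝ≥0) (b : ℝ≥0 → ℝ) (t : ℝ≥0) (n : ℕ) : ℝ :=
  ∑ j ∈ Finset.range (n + 1),
    lagIncrement (gridIndex s (step t n) (n + 1)) (fun k => b (k * step t n)) (n + 1) j *
      (b ((j + 1 : ℕ) * step t n) - b (j * step t n))

lemma tendsto_gridQV_add_lagTransform {s : ℕ → ℝ≥0} (hs : IsUnboundedPartition s) {b : ℝ≥0 → ℝ}
    (hb : Continuous b) {t : ℝ≥0} (ht : 0 < t) :
    Tendsto (fun n => gridQV b (step t n) (n + 1) + 2 * lagTransform s b t n) atTop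
      (𝓝 (b t ^ 2 - b 0 ^ 2 - 2 * leftSum s b b t)) := by
  obtain ⟨L, hL⟩ := hs.exists_le t
  have hmono := hs.strictMono.monotone
  have hL0 : L ≠ 0 := by
    rintro rfl
    rw [hs.zero] at hL
    exact absurd ht hL.not_gt
  have h1 : b t ^ 2 - b 0 ^ 2 - 2 * leftSum s b b t =
      ∑ l ∈ Finset.range L, (b (min t (s (l + 1))) - b (min t (s l))) ^ 2 := by
    have h := Finset.sum_range_sub (fun l => b (min t (s l)) ^ 2) L
    rw [hs.zero, min_eq_left hL, min_eq_right (zero_le : 0 ≤ t)] at h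
    rw [← h, leftSum_eq_sum hmono b b hL, Finset.mul_sum, ← Finset.sum_sub_distrib]
    exact Finset.sum_congr rfl fun l _ => by ring
  rw [h1]
  have h2 : Tendsto (fun n => ∑ l ∈ Finset.range L,
      (b (gridIndex s (step t n) (n + 1) (l + 1) * step t n) -
        b (gridIndex s (step t n) (n + 1) l * step t n)) ^ 2) atTop
      (𝓝 (∑ l ∈ Finset.range L, (b (min t (s (l + 1))) - b (min t (s l))) ^ 2)) :=
    tendsto_finsetSum _ fun l _ =>
      (((hb.tendsto _).comp (tendsto_gridIndex_mul hs.zero ht (l + 1))).sub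
        ((hb.tendsto _).comp (tendsto_gridIndex_mul hs.zero ht l))).pow 2
  refine h2.congr' ?_
  filter_upwards [eventually_ge_atTop L] with n hn
  have h3 := sum_sq_add_sum_sq_eq (gridIndex_mono hmono (step t n) (n + 1)) (gridIndex_zero _ _ _)
    (gridIndex_le s (step t n) (n + 1)) (fun k => b (k * step t n)) (n + 1)
  rw [gridIndex_eq_of_le ht (Nat.succ_ne_zero n) (hL.trans (hmono (by omega)))] at h3
  rw [Finset.Ico_self, Finset.sum_empty, add_zero] at h3
  rw [gridQV, lagTransform, ← h3]
  refine Finset.sum_subset (Finset.range_mono (by omega)) fun l _ hl => ?_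
  have hl' : L ≤ l := by simpa using hl
  rw [gridIndex_eq_of_le ht (by omega) (hL.trans (hmono hl')),
    gridIndex_eq_of_le ht (by omega) (hL.trans (hmono (by omega)))]
  simp

lemma eventually_abs_lagIncrement_le {s : ℕ → ℕ → ℝ≥0} (hs : ∀ n, IsUnboundedPartition (s n))
    (hmesh : ∀ ε > 0, ∀ᶠ n in atTop, ∀ k, s n (k + 1) - s n k < ε) {b : ℝ≥0 → ℝ}
    (hb : Continuous b) {t : ℝ≥0} (ht : 0 < t) (M : ℕ → ℕ) {ε : ℝ} (hε : 0 < ε) :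
    ∀ᶠ n in atTop, ∀ j < M n + 1,
      |lagIncrement (gridIndex (s n) (step t (M n)) (M n + 1))
        (fun k => b (k * step t (M n))) (M n + 1) j| ≤ ε := by
  have huc := isCompact_Icc.uniformContinuousOn_of_continuous (hb.continuousOn (s := Set.Icc 0 t))
  obtain ⟨δ, hδ, H⟩ := Metric.uniformContinuousOn_iff.1 huc ε hε
  filter_upwards [hmesh ⟨δ, hδ.le⟩ hδ] with n hn j hj
  have hpos := step_pos ht (M n)
  have hle : (j : ℝ≥0) * step t (M n) ≤ t := by
    conv_rhs => rw [← succ_mul_step t (M n)]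
    gcongr
  refine abs_lagIncrement_le (gridIndex_mono (hs n).strictMono.monotone _ _) hε.le _
    fun l hl hl' => ?_
  have hNj : (gridIndex (s n) (step t (M n)) (M n + 1) l : ℝ≥0) * step t (M n) ≤
      j * step t (M n) := by gcongr
  have h1 : (j : ℝ≥0) * step t (M n) ≤ s n (l + 1) := by
    rw [gridIndex, if_neg (Nat.succ_ne_zero l), lt_min_iff] at hl'
    rw [← le_div_iff₀ hpos]
    exact (Nat.le_floor_iff zero_le).1 (Nat.lt_succ_iff.1 hl'.2)
  have h2 : s n l ≤ gridIndex (s n) (step t (M n)) (M n + 1) l * step t (M n) := by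
    rcases l with _ | l
    · simp [(hs n).zero]
    · rw [gridIndex, if_neg (Nat.succ_ne_zero l)] at hl ⊢
      have h3 : ⌊s n (l + 1) / step t (M n)⌋₊ + 1 ≤ M n + 1 := by
        by_contra! h'
        rw [min_eq_left h'.le] at hl
        omega
      rw [min_eq_right h3, ← div_le_iff₀ hpos]
      push_cast
      exact (Nat.lt_floor_add_one _).le
  have h4 : ((s n (l + 1) - s n l : ℝ≥0) : ℝ) < δ := hn l
  rw [NNReal.coe_sub ((hs n).strictMono (Nat.lt_succ_self l)).le] at h4
  refine (H _ ⟨zero_le, hle⟩ _ ⟨zero_le, hNj.trans hle⟩ ?_).le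
  rw [NNReal.dist_eq, abs_of_nonneg (sub_nonneg.2 (by exact_mod_cast hNj))]
  have h5 := NNReal.coe_le_coe.2 h1
  have h6 := NNReal.coe_le_coe.2 h2
  linarith

section

variable {Ω : Type*} [mΩ : MeasurableSpace Ω] {P : Measure Ω} {B : ℝ≥0 → Ω → ℝ}

lemma RandomPartition.ae_isUnboundedPartition {𝔽 : Filtration ℝ≥0 mΩ} (γ : RandomPartition P 𝔽) :
    ∀ᵐ ω ∂P, IsUnboundedPartition fun l => γ.time l ω := by
  filter_upwards [γ.unbounded] with ω hω
  have hmono : StrictMono fun l => γ.time l ω := strictMono_nat_of_lt_succ fun l => γ.lt_succ l ω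
  exact ⟨γ.zero ω, hmono, tendsto_atTop_atTop_of_monotone hmono.monotone hω⟩

lemma TendsToIdentity.ae_mesh {𝔽 : Filtration ℝ≥0 mΩ} {γ : ℕ → RandomPartition P 𝔽}
    (hγ : TendsToIdentity γ) : ∀ᵐ ω ∂P, ∀ ε : ℝ≥0, 0 < ε → ∀ᶠ n in atTop, ∀ k,
      (γ n).time (k + 1) ω - (γ n).time k ω < ε := by
  filter_upwards [hγ] with ω hω ε hε
  filter_upwards [hω.eventually (gt_mem_nhds (ENNReal.coe_pos.2 hε))] with n hn k
  exact ENNReal.coe_lt_coe.1 ((le_iSup (fun k =>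
    (((γ n).time (k + 1) ω - (γ n).time k ω : ℝ≥0) : ℝ≥0∞)) k).trans_lt hn)

lemma measure_transform_ge_le [IsProbabilityMeasure P]
    (hBm : ∀ t, Measurable (B t)) (hB : IsPreBrownianReal B P) {h : ℝ≥0}
    {H : ℕ → Ω → ℝ} (hH : ∀ j : ℕ, Measurable[augmentedPast P B (j * h)] (H j)) {ε η : ℝ}
    (hHε : ∀ j ω, |H j ω| ≤ ε) (hη : 0 < η) (m : ℕ) :
    P {ω | η ≤ |∑ j ∈ Finset.range m, H j ω * (B ((j + 1 : ℕ) * h) ω - B (j * h) ω)|} ≤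
      ENNReal.ofReal (ε ^ 2 * (m * h) / η ^ 2) := by
  have hle : ∀ j : ℕ, (j : ℝ≥0) * h ≤ ((j + 1 : ℕ) : ℝ≥0) * h := fun j => by gcongr; simp
  obtain ⟨-, h2, h3⟩ := memLp_transform (P := P) (ℱ := fun j : ℕ => augmentedPast P B (j * h))
    (Δ := fun j ω => B ((j + 1 : ℕ) * h) ω - B (j * h) ω) (v := h)
    (fun i j hij => augmentedPast_mono (by gcongr)) (fun j => augmentedPast_le hBm _)
    (fun j => (measurable_augmentedPast le_rfl).sub (measurable_augmentedPast (hle j)))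
    (fun j => memLp_increment hB (hle j) (by simp)) (fun j => integral_increment hB (hle j))
    (fun j => by
      rw [integral_increment_sq hB (hle j)]
      congr 1
      push_cast
      rw [add_mul]
      simp)
    (fun j => indep_augmentedPast hB (hle j)) hH hHε m
  have h4 := mul_meas_ge_le_integral_of_nonneg
    (Eventually.of_forall fun ω => sq_nonneg _) h2.integrable_sq (η ^ 2)
  have h5 : {ω | η ≤ |∑ j ∈ Finset.range m, H j ω * (B ((j + 1 : ℕ) * h) ω - B (j * h) ω)|} =
      {ω | η ^ 2 ≤
        (∑ j ∈ Finset.range m, H j ω * (B ((j + 1 : ℕ) * h) ω - B (j * h) ω)) ^ 2} := by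
    ext ω
    simp only [Set.mem_ofPred_eq]
    rw [sq_le_sq, abs_of_pos hη]
  rw [h5, ← ENNReal.ofReal_toReal (measure_ne_top P _)]
  refine ENNReal.ofReal_le_ofReal ?_
  rw [le_div_iff₀ (by positivity), mul_comm]
  exact h4.trans h3

variable (hBm : ∀ t, Measurable (B t))

lemma measurableSet_gridIndex_le
    (γ : RandomPartition P (augmentedFiltration P (fun _ : Fin 2 => B) fun _ t => hBm t))
    {h : ℝ≥0} (hh : 0 < h) (m l : ℕ) {k j : ℕ} (hkj : k ≤ j) :
    MeasurableSet[augmentedPast P B (j * h)] {ω | gridIndex (fun l => γ.time l ω) h m l ≤ k} := by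
  have hle : augmentedPast P B (k * h) ≤ augmentedPast P B (j * h) :=
    augmentedPast_mono (by gcongr)
  refine hle _ ?_
  by_cases hl : l = 0
  · simp [gridIndex, hl]
  by_cases hm : m ≤ k
  · simp [gridIndex, hl, hm]
  have : {ω | gridIndex (fun l => γ.time l ω) h m l ≤ k} = {ω | γ.time l ω < k * h} := by
    ext ω
    simp only [gridIndex, if_neg hl, Set.mem_ofPred_eq, min_le_iff, hm, false_or]
    rw [Nat.succ_le_iff, Nat.floor_lt zero_le, div_lt_iff₀ hh]
  rw [this]
  exact measurableSet_stopping_lt hBm (γ.stopping l) _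

lemma measurable_lagIncrement_gridIndex
    (γ : RandomPartition P (augmentedFiltration P (fun _ : Fin 2 => B) fun _ t => hBm t))
    {h : ℝ≥0} (hh : 0 < h) (m L j : ℕ) :
    Measurable[augmentedPast P B (j * h)] fun ω =>
      lagIncrement (gridIndex (fun l => γ.time l ω) h m) (fun k => B (k * h) ω) L j :=
  measurable_lagIncrement (N := fun l ω => gridIndex (fun l => γ.time l ω) h m l)
    (b := fun k => B (k * h)) (fun l _ hk => measurableSet_gridIndex_le hBm γ hh m l hk)
    (fun k hk => measurable_augmentedPast (by gcongr)) L

lemma measurable_lagTransform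
    (γ : RandomPartition P (augmentedFiltration P (fun _ : Fin 2 => B) fun _ t => hBm t))
    {t : ℝ≥0} (ht : 0 < t) (n : ℕ) :
    Measurable fun ω => lagTransform (fun l => γ.time l ω) (fun u => B u ω) t n :=
  Finset.measurable_sum _ fun j _ => ((measurable_lagIncrement_gridIndex hBm γ (step_pos ht n)
    _ _ j).mono (augmentedPast_le hBm _) le_rfl).mul ((hBm _).sub (hBm _))

lemma tendstoInMeasure_lagTransform [IsProbabilityMeasure P] (hB : IsBrownianReal B P)
    {γ : ℕ → RandomPartition P (augmentedFiltration P (fun _ : Fin 2 => B) fun _ t => hBm t)}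
    (hγ : TendsToIdentity γ) {t : ℝ≥0} (ht : 0 < t) (M : ℕ → ℕ) :
    TendstoInMeasure P
      (fun n ω => lagTransform (fun l => (γ n).time l ω) (fun u => B u ω) t (M n)) atTop
      (fun _ => (0 : ℝ)) := by
  set H : ℕ → ℕ → Ω → ℝ := fun n j ω =>
    lagIncrement (gridIndex (fun l => (γ n).time l ω) (step t (M n)) (M n + 1))
      (fun k => B (k * step t (M n)) ω) (M n + 1) j with hH
  have hHm : ∀ n (j : ℕ), Measurable[augmentedPast P B (j * step t (M n))] (H n j) := fun n j =>
    measurable_lagIncrement_gridIndex hBm (γ n) (step_pos ht (M n)) _ _ j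
  have hHm' : ∀ n j, Measurable (H n j) := fun n j =>
    (hHm n j).mono (augmentedPast_le hBm _) le_rfl
  have hbad : ∀ ε > 0, Tendsto (fun n => P {ω | ∃ j < M n + 1, ε < |H n j ω|}) atTop (𝓝 0) := by
    intro ε hε
    rw [← measure_empty (μ := P)]
    refine tendsto_measure_of_ae_tendsto_indicator_of_isFiniteMeasure atTop MeasurableSet.empty
      (fun n => ?_) ?_
    · have : {ω | ∃ j < M n + 1, ε < |H n j ω|} =
          ⋃ j : ℕ, ⋃ _ : j < M n + 1, {ω | ε < |H n j ω|} := by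
        ext ω
        simp
      rw [this]
      exact MeasurableSet.iUnion fun j => MeasurableSet.iUnion fun _ =>
        measurableSet_lt measurable_const (hHm' n j).abs
    · filter_upwards [hB.cont, hγ.ae_mesh, ae_all_iff.2 fun n => (γ n).ae_isUnboundedPartition]
        with ω h1 h2 h3
      filter_upwards [eventually_abs_lagIncrement_le h3 h2 h1 ht M hε] with n hn
      simp only [Set.mem_empty_iff_false, iff_false, not_exists, not_and, not_lt]
      exact hn
  rw [tendstoInMeasure_iff_norm]
  intro η hη
  rw [ENNReal.tendsto_nhds_zero]
  intro δ hδ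
  obtain ⟨ε, hε, hεδ⟩ : ∃ ε > 0, ENNReal.ofReal (ε ^ 2 * t / η ^ 2) ≤ δ / 2 := by
    have hcont : Tendsto (fun ε : ℝ => ENNReal.ofReal (ε ^ 2 * t / η ^ 2)) (𝓝[>] 0) (𝓝 0) := by
      have : Continuous fun ε : ℝ => ENNReal.ofReal (ε ^ 2 * t / η ^ 2) :=
        ENNReal.continuous_ofReal.comp (by fun_prop)
      simpa using (this.tendsto 0).mono_left nhdsWithin_le_nhds
    obtain ⟨ε, h1, h2⟩ := ((ENNReal.tendsto_nhds_zero.1 hcont (δ / 2)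
      (ENNReal.half_pos hδ.ne')).and self_mem_nhdsWithin).exists
    exact ⟨ε, h2, h1⟩
  filter_upwards [ENNReal.tendsto_nhds_zero.1 (hbad ε hε) (δ / 2) (ENNReal.half_pos hδ.ne')]
    with n hn
  have htr := measure_transform_ge_le hBm hB.toIsPreBrownianReal (h := step t (M n))
    (H := fun j ω => if |H n j ω| ≤ ε then H n j ω else 0) (ε := ε) (η := η)
    (fun j => Measurable.ite
      (measurableSet_le (measurable_abs.comp (hHm n j)) measurable_const) (hHm n j)
        measurable_const)
    (fun j ω => by
      split_ifs with h
      · exact h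
      · simpa using hε.le) hη (M n + 1)
  rw [show ((M n + 1 : ℕ) : ℝ) * (step t (M n) : ℝ) = t by
    exact_mod_cast congrArg NNReal.toReal (succ_mul_step t (M n))] at htr
  refine (measure_mono fun ω hω => ?_).trans ((measure_union_le _ _).trans
    ((add_le_add hn (htr.trans hεδ)).trans_eq (ENNReal.add_halves δ)))
  by_cases hω' : ∃ j < M n + 1, ε < |H n j ω|
  · exact Or.inl hω'
  · right
    push Not at hω'
    simp only [Set.mem_ofPred_eq, sub_zero, Real.norm_eq_abs, lagTransform] at hω ⊢
    rwa [Finset.sum_congr rfl fun j hj => by rw [if_pos (hω' j (Finset.mem_range.1 hj))]]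

/-- The stochastic integral of Brownian motion against itself along random partitions. -/
lemma tendstoInMeasure_leftSum [IsProbabilityMeasure P] (hB : IsBrownianReal B P)
    {γ : ℕ → RandomPartition P (augmentedFiltration P (fun _ : Fin 2 => B) fun _ t => hBm t)}
    (hγ : TendsToIdentity γ) (t : ℝ≥0) :
    TendstoInMeasure P
      (fun n ω => leftSum (fun l => (γ n).time l ω) (fun u => B u ω) (fun u => B u ω) t) atTop
      (fun ω => (B t ω ^ 2 - B 0 ω ^ 2 - t) / 2) := by
  rcases eq_or_ne t 0 with rfl | ht'
  · simp only [leftSum_zero]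
    exact tendstoInMeasure_of_tendsto_ae (fun n => aestronglyMeasurable_const)
      (Eventually.of_forall fun _ => by simp)
  have ht : 0 < t := pos_iff_ne_zero.2 ht'
  set V : ℕ → ℕ → Ω → ℝ := fun n k ω => gridQV (fun u => B u ω) (step t k) (k + 1) +
    2 * lagTransform (fun l => (γ n).time l ω) (fun u => B u ω) t k with hV
  set g : ℕ → Ω → ℝ := fun n ω => B t ω ^ 2 - B 0 ω ^ 2 -
    2 * leftSum (fun l => (γ n).time l ω) (fun u => B u ω) (fun u => B u ω) t with hg
  have hVg : ∀ n, TendstoInMeasure P (V n) atTop (g n) := fun n => by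
    refine tendstoInMeasure_of_tendsto_ae (fun k => ?_) ?_
    · have h1 : Measurable fun ω => gridQV (fun u => B u ω) (step t k) (k + 1) :=
        Finset.measurable_sum _ fun j _ => ((hBm _).sub (hBm _)).pow_const 2
      exact (h1.add ((measurable_lagTransform hBm (γ n) ht k).const_mul 2)).aestronglyMeasurable
    · filter_upwards [hB.cont, (γ n).ae_isUnboundedPartition] with ω h1 h2
      exact tendsto_gridQV_add_lagTransform h2 h1 ht
  have hM : ∀ n : ℕ, ∃ k, n ≤ k ∧ P {ω | 1 / ((n : ℝ) + 1) ≤ ‖V n k ω - g n ω‖} ≤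
      ENNReal.ofReal (1 / ((n : ℝ) + 1)) := fun n => by
    have h0 : 0 < 1 / ((n : ℝ) + 1) := by positivity
    have h1 := (tendstoInMeasure_iff_norm.1 (hVg n)) _ h0
    obtain ⟨k, h2, h3⟩ := ((ENNReal.tendsto_nhds_zero.1 h1 _ (ENNReal.ofReal_pos.2 h0)).and
      (eventually_ge_atTop n)).exists
    exact ⟨k, h3, h2⟩
  choose M hMn hMP using hM
  have hMlim : Tendsto M atTop atTop := tendsto_atTop_mono hMn tendsto_id
  have hdiff : TendstoInMeasure P (fun n ω => V n (M n) ω - g n ω) atTop (fun _ => (0 : ℝ)) := by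
    refine tendstoInMeasure_of_le tendsto_one_div_add_atTop_nhds_zero_nat
      (r := fun n : ℕ => ENNReal.ofReal (1 / ((n : ℝ) + 1))) ?_ (by simpa using hMP)
    rw [← ENNReal.ofReal_zero]
    exact (ENNReal.continuous_ofReal.tendsto _).comp tendsto_one_div_add_atTop_nhds_zero_nat
  have hqv := tendstoInMeasure_gridQV hB.toIsPreBrownianReal ((tendsto_step t).comp hMlim)
    (m := fun n => M n + 1) (t := t)
    (by simpa only [Function.comp, succ_mul_step] using tendsto_const_nhds)
  have hVlim := tendstoInMeasure_add hqv
    (tendstoInMeasure_const_mul (tendstoInMeasure_lagTransform hBm hB hγ ht M) 2)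
  have hglim := tendstoInMeasure_const_mul
    (tendstoInMeasure_add hVlim (tendstoInMeasure_const_mul hdiff (-1))) (-1 / 2)
  have hconst : TendstoInMeasure P (fun (_ : ℕ) ω => (B t ω ^ 2 - B 0 ω ^ 2) / 2) atTop
      (fun ω => (B t ω ^ 2 - B 0 ω ^ 2) / 2) :=
    tendstoInMeasure_of_tendsto_ae
      (fun _ => ((((hBm t).pow_const 2).sub ((hBm 0).pow_const 2)).div_const 2).aestronglyMeasurable)
      (Eventually.of_forall fun _ => tendsto_const_nhds)
  convert tendstoInMeasure_add hconst hglim using 3 with n ω ω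
  · simp only [hV, hg, Function.comp]
    ring
  · ring

end

lemma continuous_leftSum {p : ℕ → ℝ≥0} (hp : IsUnboundedPartition p) {Z Y : ℝ≥0 → ℝ}
    (hZ : Continuous Z) (hY : Continuous Y) : Continuous (leftSum p Z Y) := by
  refine continuous_iff_continuousAt.2 fun t => ?_
  obtain ⟨L, hL⟩ := hp.exists_le (t + 1)
  have hc : Continuous fun t => ∑ l ∈ Finset.range L,
      Z (min t (p l)) * (Y (min t (p (l + 1))) - Y (min t (p l))) := by fun_prop
  refine hc.continuousAt.congr ?_
  filter_upwards [gt_mem_nhds (show t < t + 1 by simp)] with u hu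
  exact (leftSum_eq_sum hp.strictMono.monotone Z Y (hu.le.trans hL)).symm

/-- The sequence of step sizes `4⁻ⁿ`. -/
noncomputable def quarter (n : ℕ) : ℝ≥0 := (1 / 4) ^ n

lemma quarter_pos (n : ℕ) : 0 < quarter n := by unfold quarter; positivity

lemma four_mul_quarter_succ (n : ℕ) : 4 * quarter (n + 1) ≤ quarter n := by
  unfold quarter
  rw [pow_succ, mul_comm, mul_assoc]
  norm_num

lemma tendsto_quarter : Tendsto quarter atTop (𝓝 0) := by
  refine NNReal.tendsto_pow_atTop_nhds_zero_of_lt_one ?_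
  rw [div_lt_one] <;> norm_num

/-- The delays along the grids of step size `4⁻ⁿ`. -/
def alternatingDelays : Set Delay :=
  Set.range (fun n => alternating 1 (quarter n)) ∪ Set.range (fun n => alternating 0 (quarter n))

lemma exists_eq_alternating {τ : Delay} (hτ : τ ∈ alternatingDelays) :
    ∃ i n, τ = alternating i (quarter n) := by
  rcases hτ with ⟨n, rfl⟩ | ⟨n, rfl⟩
  exacts [⟨1, n, rfl⟩, ⟨0, n, rfl⟩]

lemma alternating_mem (i : Fin 2) (n : ℕ) : alternating i (quarter n) ∈ alternatingDelays := by
  fin_cases i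
  exacts [Or.inr ⟨n, rfl⟩, Or.inl ⟨n, rfl⟩]

lemma alternating_quarter_isRSDII (i : Fin 2) : IsRSDII fun n => alternating i (quarter n) :=
  alternating_isRSDII i quarter_pos four_mul_quarter_succ tendsto_quarter

lemma consistsOf_alternatingDelays : ConsistsOfContinuousPhasedRSDII alternatingDelays where
  continuous τ hτ := by
    obtain ⟨i, n, rfl⟩ := exists_eq_alternating hτ
    exact alternating_isContinuous i _
  phased τ hτ := by
    obtain ⟨i, n, rfl⟩ := exists_eq_alternating hτ
    exact alternating_isPhased i (quarter_pos n)
  rsdii τ hτ := by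
    obtain ⟨i, n, rfl⟩ := exists_eq_alternating hτ
    exact ⟨_, alternating_quarter_isRSDII i, alternating_mem i, n, rfl⟩

lemma alternating_phased_path (b : ℝ≥0 → ℝ) (i c : Fin 2) {h : ℝ≥0} (hh : 0 < h) (l : ℕ) :
    (∀ u ∈ Set.Icc (halfGrid h l) (halfGrid h (l + 1)),
      b ((alternating i h).toFun c u) = b ((alternating i h).toFun c (halfGrid h l))) ∨
    (∀ u ∈ Set.Icc (halfGrid h l) (halfGrid h (l + 1)),
      b ((alternating i h).toFun (1 - c) u) =
        b ((alternating i h).toFun (1 - c) (halfGrid h l))) := by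
  have h1 : c = i ∧ 1 - c ≠ i ∨ c ≠ i ∧ 1 - c = i := by revert c i; decide
  simp only [alternating]
  rcases h1 with ⟨h1, h2⟩ | ⟨h1, h2⟩
  · rw [if_pos h1, if_neg h2]
    exact (lagFun_phased hh l).symm.imp (fun H u hu => by rw [H u hu]) fun H u hu => by rw [H u hu]
  · rw [if_neg h1, if_pos h2]
    exact (lagFun_phased hh l).imp (fun H u hu => by rw [H u hu]) fun H u hu => by rw [H u hu]

section

variable {Ω : Type*} {B : ℝ≥0 → Ω → ℝ}

/-- The decomposition of the product of a process delayed by `alternating i h`. -/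
noncomputable def phasedDecomposition (B : ℝ≥0 → Ω → ℝ) (i : Fin 2) (h : ℝ≥0) (c : Fin 2)
    (t : ℝ≥0) (ω : Ω) : ℝ :=
  leftSum (halfGrid h) (fun u => B ((alternating i h).toFun (1 - c) u) ω)
    (fun u => B ((alternating i h).toFun c u) ω) t

lemma continuous_phasedDecomposition {ω : Ω} (hω : Continuous (B · ω)) (i : Fin 2) {h : ℝ≥0}
    (hh : 0 < h) (c : Fin 2) : Continuous fun t => phasedDecomposition B i h c t ω :=
  continuous_leftSum (isUnboundedPartition_halfGrid hh)
    (hω.comp (alternating_isContinuous i h _)) (hω.comp (alternating_isContinuous i h _))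

lemma phasedDecomposition_add {i : Fin 2} {h : ℝ≥0} (hh : 0 < h) (c : Fin 2) (t : ℝ≥0) (ω : Ω) :
    phasedDecomposition B i h c t ω + phasedDecomposition B i h (1 - c) t ω =
      B ((alternating i h).toFun c t) ω * B ((alternating i h).toFun (1 - c) t) ω -
        B 0 ω ^ 2 := by
  have h1 := leftSum_add_leftSum_of_phased (isUnboundedPartition_halfGrid hh)
    (alternating_phased_path (B · ω) i c hh) t
  have h0 : ∀ j, (alternating i h).toFun j 0 = 0 := fun j =>
    nonpos_iff_eq_zero.1 ((alternating i h).le_self j 0)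
  rw [h0, h0, ← pow_two] at h1
  rw [← h1, phasedDecomposition, phasedDecomposition, sub_sub_cancel]

end

section

variable {Ω : Type*} [mΩ : MeasurableSpace Ω] {P : Measure Ω} {B : ℝ≥0 → Ω → ℝ}

/-! ### Measurability at random times -/

lemma aemeasurable_randomTime (hBm : ∀ t, Measurable (B t)) (hB : ∀ᵐ ω ∂P, Continuous (B · ω))
    {ρ : Ω → ℝ≥0} (hρ : Measurable ρ) : AEMeasurable (fun ω => B (ρ ω) ω) P := by
  refine aemeasurable_of_tendsto_metrizable_ae atTop
    (f := fun k ω => B ((⌊ρ ω / step 1 k⌋₊ - 0 : ℕ) * step 1 k) ω) (fun k => ?_) ?_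
  · have h1 : Measurable fun q : ℕ × Ω => B ((q.1 - 0 : ℕ) * step 1 k) q.2 :=
      measurable_from_prod_countable_right fun j => by exact hBm ((j - 0 : ℕ) * step 1 k)
    exact (h1.comp ((Nat.measurable_floor.comp (hρ.div_const _)).prodMk measurable_id)).aemeasurable
  · filter_upwards [hB] with ω hω
    exact (hω.tendsto _).comp (tendsto_floor_mul (step_pos one_pos) (tendsto_step 1) (ρ ω) 0)

lemma RandomPartition.measurable_time {𝔽 : Filtration ℝ≥0 mΩ} (γ : RandomPartition P 𝔽) (l : ℕ) :
    Measurable (γ.time l) := by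
  refine measurable_of_Iic fun t => ?_
  have := 𝔽.le t _ (γ.stopping l t)
  simp only [WithTop.coe_le_coe] at this
  exact this

lemma aemeasurable_leftSum (hBm : ∀ t, Measurable (B t)) (hB : ∀ᵐ ω ∂P, Continuous (B · ω))
    {σ : ℕ → Ω → ℝ≥0} (hσ : ∀ l, Measurable (σ l))
    (hσ' : ∀ᵐ ω ∂P, IsUnboundedPartition fun l => σ l ω) {f g : ℝ≥0 → ℝ≥0} (hf : Continuous f)
    (hg : Continuous g) (t : ℝ≥0) :
    AEMeasurable (fun ω => leftSum (fun l => σ l ω) (fun u => B (f u) ω) (fun u => B (g u) ω) t)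
      P := by
  refine aemeasurable_of_tendsto_metrizable_ae atTop
    (f := fun k ω => ∑ l ∈ Finset.range k, B (f (min t (σ l ω))) ω *
      (B (g (min t (σ (l + 1) ω))) ω - B (g (min t (σ l ω))) ω)) (fun k => ?_) ?_
  · have key : ∀ {f : ℝ≥0 → ℝ≥0}, Continuous f → ∀ l,
        AEMeasurable (fun ω => B (f (min t (σ l ω))) ω) P := fun hf l =>
      aemeasurable_randomTime hBm hB (hf.measurable.comp (measurable_const.min (hσ l)))
    exact Finset.aemeasurable_fun_sum _ fun l _ =>
      (key hf l).mul ((key hg (l + 1)).sub (key hg l))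
  · filter_upwards [hσ'] with ω hω
    obtain ⟨L, hL⟩ := hω.exists_le t
    refine tendsto_const_nhds.congr' ?_
    filter_upwards [eventually_ge_atTop L] with k hk
    exact leftSum_eq_sum hω.strictMono.monotone _ _ (hL.trans (hω.strictMono.monotone hk))

/-! ### The decompositions -/

lemma mem_cadlagFromZero {D : ℝ≥0 → Ω → ℝ} (hm : ∀ t, AEMeasurable (D t) P)
    (h : ∀ᵐ ω ∂P, D 0 ω = 0 ∧ Continuous fun u => D u ω) : D ∈ cadlagFromZero P := by
  refine ⟨hm, ?_⟩
  filter_upwards [h] with ω hω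
  exact ⟨hω.1, fun t => ⟨hω.2.continuousWithinAt, _,
    (hω.2.tendsto t).mono_left nhdsWithin_le_nhds⟩⟩

lemma phasedDecomposition_mem (hBm : ∀ t, Measurable (B t)) (hB : ∀ᵐ ω ∂P, Continuous (B · ω))
    (i : Fin 2) {h : ℝ≥0} (hh : 0 < h) (c : Fin 2) :
    phasedDecomposition B i h c ∈ cadlagFromZero P := by
  refine mem_cadlagFromZero (fun t => ?_) ?_
  · exact aemeasurable_leftSum hBm hB (σ := fun l _ => halfGrid h l) (fun _ => measurable_const)
      (Eventually.of_forall fun _ => isUnboundedPartition_halfGrid hh)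
      (alternating_isContinuous i h _) (alternating_isContinuous i h _) t
  · filter_upwards [hB] with ω hω
    exact ⟨leftSum_zero _ _ _, continuous_phasedDecomposition hω i hh c⟩

/-! ### Limits along the delays -/

lemma tendstoInMeasure_phasedDecomposition_one [IsProbabilityMeasure P]
    (hBm : ∀ t, Measurable (B t)) (hB : IsBrownianReal B P) (t : ℝ≥0) :
    TendstoInMeasure P (fun n => phasedDecomposition B 1 (quarter n) 0 t) atTop
      (fun ω => (1 / 2 : ℝ) * B t ω ^ 2 + (1 / 2 : ℝ) * t) := by
  have h1 : TendstoInMeasure P (fun n ω => phasedDecomposition B 1 (quarter n) 0 t ω -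
      gridQV (B · ω) (quarter n) (⌊t / quarter n⌋₊ - 1) / 2) atTop
      (fun ω => (B t ω ^ 2 - B 0 ω ^ 2) / 2) := by
    refine tendstoInMeasure_of_tendsto_ae (fun n => ?_) ?_
    · have h2 : Measurable fun ω => gridQV (B · ω) (quarter n) (⌊t / quarter n⌋₊ - 1) :=
        Finset.measurable_sum _ fun j _ => ((hBm _).sub (hBm _)).pow_const 2
      exact (((phasedDecomposition_mem hBm hB.cont 1 (quarter_pos n) 0).1 t).sub
        (h2.div_const 2).aemeasurable).aestronglyMeasurable
    · filter_upwards [hB.cont] with ω hω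
      exact tendsto_leftSum_lag_sub hω quarter_pos tendsto_quarter t
  have h2 := tendstoInMeasure_const_mul (tendstoInMeasure_gridQV hB.toIsPreBrownianReal
    tendsto_quarter (tendsto_floor_mul quarter_pos tendsto_quarter t 1)) (1 / 2)
  refine ((tendstoInMeasure_add h1 h2).congr_right ?_).congr_left fun n => ?_
  · filter_upwards [hB.eval_zero_ae_eq_zero] with ω hω
    rw [hω]
    ring
  · filter_upwards with ω
    ring

lemma tendstoInMeasure_phasedDecomposition_zero [IsProbabilityMeasure P]
    (hBm : ∀ t, Measurable (B t)) (hB : IsBrownianReal B P) (t : ℝ≥0) :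
    TendstoInMeasure P (fun n => phasedDecomposition B 0 (quarter n) 0 t) atTop
      (fun ω => (1 / 2 : ℝ) * B t ω ^ 2 - (1 / 2 : ℝ) * t) := by
  have hsymm : ∀ n ω, phasedDecomposition B 0 (quarter n) 1 t ω =
      phasedDecomposition B 1 (quarter n) 0 t ω := fun n ω => rfl
  have h1 : TendstoInMeasure P (fun n ω => phasedDecomposition B 0 (quarter n) 0 t ω +
      phasedDecomposition B 0 (quarter n) 1 t ω) atTop (fun ω => B t ω ^ 2 - B 0 ω ^ 2) := by
    refine tendstoInMeasure_of_tendsto_ae (fun n => ?_) ?_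
    · exact (((phasedDecomposition_mem hBm hB.cont 0 (quarter_pos n) 0).1 t).add
        ((phasedDecomposition_mem hBm hB.cont 0 (quarter_pos n) 1).1 t)).aestronglyMeasurable
    · filter_upwards [hB.cont] with ω hω
      have hlag : ∀ j, Tendsto (fun n => B ((alternating 0 (quarter n)).toFun j t) ω) atTop
          (𝓝 (B t ω)) := fun j => (hω.tendsto t).comp
        (tendsto_lagFun (by split_ifs <;> simp) tendsto_quarter t)
      have := ((hlag 0).mul (hlag 1)).sub_const (B 0 ω ^ 2)
      rw [← pow_two] at this
      exact this.congr fun n => (phasedDecomposition_add (quarter_pos n) 0 t ω).symm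
  have h2 := tendstoInMeasure_const_mul (tendstoInMeasure_phasedDecomposition_one hBm hB t) (-1)
  refine ((tendstoInMeasure_add h1 h2).congr_right ?_).congr_left fun n => ?_
  · filter_upwards [hB.eval_zero_ae_eq_zero] with ω hω
    rw [hω]
    ring
  · filter_upwards with ω
    rw [hsymm]
    ring

lemma leftLim_ae_eq {D E : ℝ≥0 → Ω → ℝ} (hD : D ∈ cadlagFromZero P)
    (hE : ∀ᵐ ω ∂P, Continuous (E · ω)) (hDE : ∀ t, D t =ᵐ[P] E t) {t : ℝ≥0} (ht : 0 < t) :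
    (fun ω => Function.leftLim (fun u => D u ω) t) =ᵐ[P] E t := by
  obtain ⟨u, -, hu, hut⟩ := exists_seq_strictMono_tendsto' ht
  have hu' : Tendsto u atTop (𝓝[<] t) :=
    tendsto_nhdsWithin_iff.2 ⟨hut, Eventually.of_forall fun n => (hu n).2⟩
  filter_upwards [hD.2, hE, ae_all_iff.2 fun n => hDE (u n)] with ω h1 h2 h3
  obtain ⟨a, ha⟩ := (h1.2 t).2
  have h4 : Tendsto (fun n => E (u n) ω) atTop (𝓝 a) := (ha.comp hu').congr h3
  have h5 := tendsto_nhds_unique h4 ((h2.tendsto t).comp hut)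
  rw [← h5]
  have := hu'.neBot
  exact leftLim_eq_of_tendsto ha

/-! ### Existence of the decompositions -/

variable [IsProbabilityMeasure P] (hBm : ∀ t, Measurable (B t))
  {γ : ℕ → RandomPartition P (augmentedFiltration P (fun _ : Fin 2 => B) fun _ t => hBm t)}

lemma isISUDecomposition_delayed (hB : ∀ᵐ ω ∂P, Continuous (B · ω)) (hγ : TendsToIdentity γ)
    (i : Fin 2) {h : ℝ≥0} (hh : 0 < h) (π : Equiv.Perm (Fin 2)) :
    IsISUDecomposition productFunctional (delayed (fun _ => B) (alternating i h)) π γ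
      (phasedDecomposition B i h) := by
  intro c t
  have hne : π c ≠ π (1 - c) := π.injective.ne (by revert c; decide)
  have hcont := alternating_isContinuous i h
  have hlim : ∀ d : Fin 2, ∀ᵐ ω ∂P, Tendsto (fun n => leftSum (fun l => (γ n).time l ω)
      (fun u => B ((alternating i h).toFun (1 - d) u) ω)
      (fun u => B ((alternating i h).toFun d u) ω) t) atTop
      (𝓝 (phasedDecomposition B i h d t ω)) := fun d => by
    filter_upwards [hB, hγ.ae_mesh, ae_all_iff.2 fun n => (γ n).ae_isUnboundedPartition]
      with ω h1 h2 h3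
    exact tendsto_leftSum_of_phased (h1.comp (hcont _)) (h1.comp (hcont _))
      (isUnboundedPartition_halfGrid hh) (alternating_phased_path (B · ω) i d hh) h3 h2 t
  have hmeas : ∀ n, ∀ d e : Fin 2, AEMeasurable (fun ω => leftSum (fun l => (γ n).time l ω)
      (fun u => B ((alternating i h).toFun e u) ω)
      (fun u => B ((alternating i h).toFun d u) ω) t) P := fun n d e =>
    aemeasurable_leftSum hBm hB (γ n).measurable_time (γ n).ae_isUnboundedPartition
      (hcont _) (hcont _) t
  rcases hne.lt_or_gt with h1 | h1
  · have heq : ∀ n, suDecomposition productFunctional (delayed (fun _ => B) (alternating i h)) π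
        (γ n).time c t = fun ω => leftSum (fun l => (γ n).time l ω)
          (fun u => B ((alternating i h).toFun (1 - c) u) ω)
          (fun u => B ((alternating i h).toFun c u) ω) t := fun n =>
      funext fun ω => suDecomposition_of_lt h1 t ω
    simp_rw [heq]
    exact tendstoInMeasure_of_tendsto_ae (fun n => (hmeas n c (1 - c)).aestronglyMeasurable)
      (hlim c)
  · have heq : ∀ n, suDecomposition productFunctional (delayed (fun _ => B) (alternating i h)) π
        (γ n).time c t =ᵐ[P] fun ω => B ((alternating i h).toFun c t) ω *
          B ((alternating i h).toFun (1 - c) t) ω - B 0 ω ^ 2 -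
          leftSum (fun l => (γ n).time l ω) (fun u => B ((alternating i h).toFun c u) ω)
          (fun u => B ((alternating i h).toFun (1 - c) u) ω) t := fun n => by
      filter_upwards [(γ n).ae_isUnboundedPartition] with ω hω
      rw [suDecomposition_of_gt h1 hω]
      have h0 : ∀ j, (alternating i h).toFun j 0 = 0 := fun j =>
        nonpos_iff_eq_zero.1 ((alternating i h).le_self j 0)
      simp only [delayed, h0, pow_two]
    refine TendstoInMeasure.congr_left (fun n => (heq n).symm) ?_
    refine tendstoInMeasure_of_tendsto_ae (fun n => ?_) ?_
    · exact ((((hBm _).mul (hBm _)).sub ((hBm 0).pow_const 2)).aemeasurable.sub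
        (hmeas n (1 - c) c)).aestronglyMeasurable
    · filter_upwards [hlim (1 - c)] with ω hω
      rw [sub_sub_cancel] at hω
      have := phasedDecomposition_add (B := B) (i := i) hh c t ω
      rw [← eq_sub_iff_add_eq] at this
      rw [this]
      exact hω.const_sub _

lemma exists_isISUDecomposition_self (hB : IsBrownianReal B P) (hγ : TendsToIdentity γ)
    (π : Equiv.Perm (Fin 2)) :
    ∃ D : Fin 2 → ℝ≥0 → Ω → ℝ, (∀ c, D c ∈ cadlagFromZero P) ∧
      IsISUDecomposition productFunctional (fun _ => B) π γ D := by
  refine ⟨fun c t ω => if π c < π (1 - c) then (B t ω ^ 2 - B 0 ω ^ 2 - t) / 2 else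
    (B t ω ^ 2 - B 0 ω ^ 2 + t) / 2, fun c => ?_, fun c t => ?_⟩
  · refine mem_cadlagFromZero (fun t => ?_) ?_
    · have := hBm t
      have := hBm 0
      dsimp only
      split_ifs <;> fun_prop
    · filter_upwards [hB.cont] with ω hω
      split_ifs
      · exact ⟨by simp, by fun_prop⟩
      · exact ⟨by simp, by fun_prop⟩
  have hne : π c ≠ π (1 - c) := π.injective.ne (by revert c; decide)
  have hlim := tendstoInMeasure_leftSum hBm hB hγ t
  rcases hne.lt_or_gt with h1 | h1
  · simp only [if_pos h1]
    have heq : ∀ n, suDecomposition productFunctional (fun _ => B) π (γ n).time c t =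
        fun ω => leftSum (fun l => (γ n).time l ω) (fun u => B u ω) (fun u => B u ω) t :=
      fun n => funext fun ω => suDecomposition_of_lt h1 t ω
    simp_rw [heq]
    exact hlim
  · simp only [if_neg h1.not_gt]
    refine TendstoInMeasure.congr_left (f := fun n ω => (B t ω ^ 2 - B 0 ω ^ 2) + (-1) *
      leftSum (fun l => (γ n).time l ω) (fun u => B u ω) (fun u => B u ω) t) (fun n => ?_) ?_
    · filter_upwards [(γ n).ae_isUnboundedPartition] with ω hω
      rw [suDecomposition_of_gt h1 hω]
      ring
    · have hconst : TendstoInMeasure P (fun (_ : ℕ) ω => B t ω ^ 2 - B 0 ω ^ 2) atTop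
          (fun ω => B t ω ^ 2 - B 0 ω ^ 2) :=
        tendstoInMeasure_of_tendsto_ae
          (fun _ => (((hBm t).pow_const 2).sub ((hBm 0).pow_const 2)).aestronglyMeasurable)
          (Eventually.of_forall fun _ => tendsto_const_nhds)
      convert tendstoInMeasure_add hconst (tendstoInMeasure_const_mul hlim (-1)) using 2 with ω
      ring

lemma ae_eq_of_isISUScheme (hB : ∀ᵐ ω ∂P, Continuous (B · ω)) (hγ : TendsToIdentity γ)
    {π : Equiv.Perm (Fin 2)} {δ : (Fin 2 → ℝ≥0 → Ω → ℝ) → Fin 2 → ℝ≥0 → Ω → ℝ}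
    (hδ : IsISUScheme productFunctional (fun _ : Fin 2 => B) alternatingDelays π γ δ)
    (i : Fin 2) (n : ℕ) (c : Fin 2) (t : ℝ≥0) :
    δ (delayed (fun _ => B) (alternating i (quarter n))) c t =ᵐ[P]
      phasedDecomposition B i (quarter n) c t :=
  tendstoInMeasure_ae_unique
    (hδ.isISU _ (Or.inl ⟨_, alternating_mem i n, rfl⟩) c t)
    (isISUDecomposition_delayed hBm hB hγ i (quarter_pos n) π c t)

lemma exists_isISUScheme (hB : IsBrownianReal B P) (hγ : TendsToIdentity γ)
    (π : Equiv.Perm (Fin 2)) :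
    ∃ δ, IsISUScheme productFunctional (fun _ : Fin 2 => B) alternatingDelays π γ δ := by
  classical
  have h : ∀ Y ∈ delayedFamily (fun _ : Fin 2 => B) alternatingDelays,
      ∃ D : Fin 2 → ℝ≥0 → Ω → ℝ, (∀ c, D c ∈ cadlagFromZero P) ∧
        IsISUDecomposition productFunctional Y π γ D := by
    rintro Y (⟨τ, hτ, rfl⟩ | rfl)
    · obtain ⟨i, n, rfl⟩ := exists_eq_alternating hτ
      exact ⟨_, phasedDecomposition_mem hBm hB.cont i (quarter_pos n),
        isISUDecomposition_delayed hBm hB.cont hγ i (quarter_pos n) π⟩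
    · exact exists_isISUDecomposition_self hBm hB hγ π
  choose! δ h1 h2 using h
  exact ⟨δ, h1, h2⟩

end

end ISU

theorem mainTheorem10 {Ω : Type*} [MeasurableSpace Ω] (P : Measure Ω) [IsProbabilityMeasure P]
    (B : ℝ≥0 → Ω → ℝ) (hBm : ∀ t, Measurable (B t)) (hB : IsBrownianReal B P) :
    ∃ T : Set ISU.Delay, ISU.ConsistsOfContinuousPhasedRSDII T ∧
      (∀ Y ∈ ISU.delayedFamily (fun _ : Fin 2 => B) T,
        ISU.productFunctional Y ∈ ISU.cadlagFromZero P) ∧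
      ∃ τ τ' : ℕ → ISU.Delay,
        (ISU.IsRSDII τ ∧ ∀ n, τ n ∈ T) ∧ (ISU.IsRSDII τ' ∧ ∀ n, τ' n ∈ T) ∧
        ∀ (π : Equiv.Perm (Fin 2))
          (γ : ℕ → ISU.RandomPartition P
            (ISU.augmentedFiltration P (fun _ : Fin 2 => B) (fun _ t => hBm t))),
          ISU.TendsToIdentity γ →
          (∃ δ, ISU.IsISUScheme ISU.productFunctional (fun _ : Fin 2 => B) T π γ δ) ∧
          ∀ δ, ISU.IsISUScheme ISU.productFunctional (fun _ : Fin 2 => B) T π γ δ →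
            (∀ t : ℝ≥0, TendstoInMeasure P
              (fun n => δ (ISU.delayed (fun _ : Fin 2 => B) (τ n)) 0 t) atTop
              (fun ω => (1 / 2 : ℝ) * B t ω ^ 2 + (1 / 2 : ℝ) * (t : ℝ))) ∧
            (∀ t : ℝ≥0, TendstoInMeasure P
              (fun n => δ (ISU.delayed (fun _ : Fin 2 => B) (τ' n)) 0 t) atTop
              (fun ω => (1 / 2 : ℝ) * B t ω ^ 2 - (1 / 2 : ℝ) * (t : ℝ))) ∧
            ¬ ISU.StableAt P T (fun _ : Fin 2 => B) δ := by
  refine ⟨ISU.alternatingDelays, ISU.consistsOf_alternatingDelays, ?_,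
    fun n => ISU.alternating 1 (ISU.quarter n), fun n => ISU.alternating 0 (ISU.quarter n),
    ⟨ISU.alternating_quarter_isRSDII 1, ISU.alternating_mem 1⟩,
    ⟨ISU.alternating_quarter_isRSDII 0, ISU.alternating_mem 0⟩, fun π γ hγ =>
    ⟨ISU.exists_isISUScheme hBm hB hγ π, fun δ hδ => ?_⟩⟩
  · rintro Y (⟨τ, hτ, rfl⟩ | rfl)
    · refine ISU.mem_cadlagFromZero (fun t => ((hBm _).mul (hBm _)).aemeasurable) ?_
      filter_upwards [hB.cont, hB.eval_zero_ae_eq_zero] with ω h1 h2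
      have hc := ISU.consistsOf_alternatingDelays.continuous τ hτ
      have h0 : τ.toFun 0 0 = 0 := nonpos_iff_eq_zero.1 (τ.le_self 0 0)
      exact ⟨by simp [ISU.productFunctional, ISU.delayed, h0, h2],
        (h1.comp (hc 0)).mul (h1.comp (hc 1))⟩
    · refine ISU.mem_cadlagFromZero (fun t => ((hBm _).mul (hBm _)).aemeasurable) ?_
      filter_upwards [hB.cont, hB.eval_zero_ae_eq_zero] with ω h1 h2
      exact ⟨by simp [ISU.productFunctional, h2], h1.mul h1⟩
  · have hae := ISU.ae_eq_of_isISUScheme hBm hB.cont hγ hδ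
    refine ⟨fun t => (ISU.tendstoInMeasure_phasedDecomposition_one hBm hB t).congr_left
      fun n => (hae 1 n 0 t).symm, fun t =>
      (ISU.tendstoInMeasure_phasedDecomposition_zero hBm hB t).congr_left
      fun n => (hae 0 n 0 t).symm, fun hst => ?_⟩
    have hlim : ∀ i n, (fun ω => Function.leftLim (fun u =>
        δ (ISU.delayed (fun _ => B) (ISU.alternating i (ISU.quarter n))) 0 u ω) 1) =ᵐ[P]
        ISU.phasedDecomposition B i (ISU.quarter n) 0 1 := fun i n =>
      ISU.leftLim_ae_eq (hδ.cadlag _ (Or.inl ⟨_, ISU.alternating_mem i n, rfl⟩) 0)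
        (by
          filter_upwards [hB.cont] with ω hω
          exact ISU.continuous_phasedDecomposition hω i (ISU.quarter_pos n) 0)
        (hae i n 0) one_pos
    have h1 := (hst _ (ISU.alternating_quarter_isRSDII 1) (ISU.alternating_mem 1) 0 1).congr_left
      (hlim 1)
    have h2 := (hst _ (ISU.alternating_quarter_isRSDII 0) (ISU.alternating_mem 0) 0 1).congr_left
      (hlim 0)
    have h3 := tendstoInMeasure_ae_unique h1
      (ISU.tendstoInMeasure_phasedDecomposition_one hBm hB 1)
    have h4 := tendstoInMeasure_ae_unique h2
      (ISU.tendstoInMeasure_phasedDecomposition_zero hBm hB 1)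
    obtain ⟨ω, h5, h6⟩ := (h3.and h4).exists
    rw [h5] at h6
    norm_num at h6
    linarith
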